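/- Consider the system $x_{t+1}=A_\star x_t+B_\star u_t+w_t$, $x_t\in\mathbb R^n$ ($n\ge 1$), $u_t\in\mathbb R^m$, $m\le n$, where $w_t$ is zero-mean noise, uncorrelated in time, with $\mathbb E(w_tw_t^\top)=\sigma_w^2I$, and $x_0$ is uncorrelated with the noise, with $\mathbb E(x_0)=0$, $\mathbb E(x_0x_0^\top)=\sigma_x^2I$. Let $Q\succeq I$, $R\succeq I$ be symmetric and $(A_\star,B_\star)$ stabilizable. Write $\|\cdot\|$ for the spectral norm, $\overline\sigma,\underline\sigma$ for the largest and smallest singular value, and for a model $(A,B)$ $$\mathcal R_{A,B}(P)=A^\top P(I+BR^{-1}B^\top P)^{-1}A+Q,\qquad \mathcal K_{A,B}(F)=(R+B^\top FB)^{-1}B^\top FA,$$ with $\mathcal R^{(i)}_{A,B}$ the $i$-fold iterate of $\mathcal R_{A,B}$. Let $P_\star\succ0$ be the positive-definite solution of $P_\star=\mathcal R_{A_\star,B_\star}(P_\star)$ and $K_\star=\mathcal K_{A_\star,B_\star}(P_\star)$. For a gain $K$ let $$J_K=\lim_{T\to\infty}\frac1T\,\mathbb E\Big[\sum_{t=0}^{T-1}\big(x_t^\top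 Qx_t+u_t^\top Ru_t\big)\Big]\quad\text{with } u_t=-Kx_t .$$ Let $\varepsilon_{\mathrm m},\varepsilon_{\mathrm p}\ge0$, let $(\hat A,\hat B)$ satisfy $\|\hat A-A_\star\|\le\varepsilon_{\mathrm m}$, $\|\hat B-B_\star\|\le\varepsilon_{\mathrm m}$, let $P\succeq0$ satisfy $\|P-P_\star\|\le\varepsilon_{\mathrm p}$, and let $\Upsilon_\star\ge\max\{1,\varepsilon_{\mathrm m}\}$ be an upper bound of $\|A_\star\|,\|B_\star\|,\|P_\star\|$. For $N\ge1$, consider the nominal receding-horizon controller which at each time $t$ measures $x_t$, minimizes over $u_{0|t},\dots,u_{N-1|t}$ $$\mathbb E_{w}\Big[\sum_{k=0}^{N-1}\big(x_{k|t}^\top Qx_{k|t}+u_{k|t}^\top Ru_{k|t}\big)+x_{N|t}^\top Px_{N|t}\Big]\quad\text{s.t. } x_{k+1|t}=\hat Ax_{k|t}+\hat Bu_{k|t}+w_{k+t},\ x_{0|t}=x_t,$$ and applies $u_t=u_{0|t}$; equivalently, $u_t=-K_{\mathrm{mpc}}x_t$ with $K_{\mathrm{mpc}}=\mathcal K_{\hat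 A,\hat B}\big(\mathcal R^{(N-1)}_{\hat A,\hat B}(P)\big)$. Put $\beta_\star=\overline\sigma(P_\star)/\underline\sigma(Q)$ and $$\psi=\varepsilon_{\mathrm m}\big[1+(\varepsilon_{\mathrm m}+2\Upsilon_\star)^2(\beta_\star\varepsilon_{\mathrm p}+\Upsilon_\star)\big],\qquad \tilde\psi=(\varepsilon_{\mathrm m}^2+2\Upsilon_\star\varepsilon_{\mathrm m})\big[\Upsilon_\star+(\varepsilon_{\mathrm m}+\Upsilon_\star)^2\Upsilon_\star^2\big],$$ $$\gamma_1=\sqrt{\beta_\star}\,\psi+\sqrt{1-\beta_\star^{-1}},\qquad \alpha=(1-8\|P_\star\|^2\varepsilon_{\mathrm m})^{-1/2},\qquad \gamma_2=\sqrt{1-\alpha^{-1}\beta_\star^{-1}},$$ $$\widehat E(\varepsilon_{\mathrm m},\varepsilon_{\mathrm p},i)=\sqrt{\alpha}\,\beta_\star\Big\{(\gamma_1\gamma_2)^i\varepsilon_{\mathrm p}+\tilde\psi\,\frac{1-(\gamma_1\gamma_2)^i}{1-\gamma_1\gamma_2}\Big\}.$$ If $$\varepsilon_{\mathrm m}+\widehat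 E(\varepsilon_{\mathrm m},\varepsilon_{\mathrm p},N-1)\le\frac1{40\,\Upsilon_\star^4\|P_\star\|^2},$$ then $\gamma_1\gamma_2<1$, the matrix $A_\star-B_\star K_{\mathrm{mpc}}$ is Schur stable, the limits $J_{K_{\mathrm{mpc}}}$ and $J_{K_\star}$ exist, and $$J_{K_{\mathrm{mpc}}}-J_{K_\star}\le 128\,m\,\sigma_w^2\,\big(\overline\sigma(R)+\Upsilon_\star^3\big)\,\Upsilon_\star^4\,\|P_\star\|^2\,\big[\varepsilon_{\mathrm m}+\widehat E(\varepsilon_{\mathrm m},\varepsilon_{\mathrm p},N-1)\big]^2 .$$ -/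

import Mathlib

open MeasureTheory Filter Topology
open scoped Matrix Matrix.Norms.L2Operator

/- With `Matrix.Norms.L2Operator` open, `‖M‖` is the spectral norm (largest singular value) of a
real matrix `M`. -/

namespace LQ

noncomputable section

/-! ### Linear systems, Riccati mapping and gains -/

/-- A real square matrix is Schur stable: every complex eigenvalue has modulus less than one. -/
def IsSchurStable {n : ℕ} (M : Matrix (Fin n) (Fin n) ℝ) : Prop :=
  ∀ z ∈ spectrum ℂ (M.map (fun r : ℝ => (r : ℂ))), ‖z‖ < 1

/-- The pair `(A, B)` is stabilizable: some linear static feedback makes it Schur stable. -/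
def IsStabilizable {n m : ℕ} (A : Matrix (Fin n) (Fin n) ℝ) (B : Matrix (Fin n) (Fin m) ℝ) :
    Prop :=
  ∃ K : Matrix (Fin m) (Fin n) ℝ, IsSchurStable (A - B * K)

/-- `S_B = B R⁻¹ Bᵀ`. -/
def sMat {n m : ℕ} (B : Matrix (Fin n) (Fin m) ℝ) (R : Matrix (Fin m) (Fin m) ℝ) :
    Matrix (Fin n) (Fin n) ℝ :=
  B * R⁻¹ * Bᵀ

/-- The Riccati mapping `P ↦ Aᵀ P (I + S_B P)⁻¹ A + Q`. -/
def riccati {n m : ℕ} (A : Matrix (Fin n) (Fin n) ℝ) (B : Matrix (Fin n) (Fin m) ℝ)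
    (Q : Matrix (Fin n) (Fin n) ℝ) (R : Matrix (Fin m) (Fin m) ℝ)
    (P : Matrix (Fin n) (Fin n) ℝ) : Matrix (Fin n) (Fin n) ℝ :=
  Aᵀ * P * (1 + sMat B R * P)⁻¹ * A + Q

/-- The gain `(R + Bᵀ F B)⁻¹ Bᵀ F A`. -/
def gain {n m : ℕ} (A : Matrix (Fin n) (Fin n) ℝ) (B : Matrix (Fin n) (Fin m) ℝ)
    (R : Matrix (Fin m) (Fin m) ℝ) (F : Matrix (Fin n) (Fin n) ℝ) :
    Matrix (Fin m) (Fin n) ℝ :=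
  (R + Bᵀ * F * B)⁻¹ * Bᵀ * F * A

/-- The receding-horizon gain with prediction horizon `N` and terminal matrix `P`:
`(R + Bᵀ F B)⁻¹ Bᵀ F A`, where `F` is the `(N - 1)`-st Riccati iterate of `P`. -/
def mpcGain {n m : ℕ} (A : Matrix (Fin n) (Fin n) ℝ) (B : Matrix (Fin n) (Fin m) ℝ)
    (Q : Matrix (Fin n) (Fin n) ℝ) (R : Matrix (Fin m) (Fin m) ℝ)
    (P : Matrix (Fin n) (Fin n) ℝ) (N : ℕ) : Matrix (Fin m) (Fin n) ℝ :=
  gain A B R ((riccati A B Q R)^[N - 1] P)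

/-! ### Stochastic model, receding-horizon problem and average cost -/

/-- The initial state has mean zero and covariance `σx² I`, the noise is white (mean zero,
covariance `σw² I`, uncorrelated in time), and the two are uncorrelated. -/
structure IsNoiseModel {n : ℕ} {Ω : Type*} [MeasurableSpace Ω] (μ : Measure Ω)
    (x₀ : Ω → Fin n → ℝ) (w : ℕ → Ω → Fin n → ℝ) (σx σw : ℝ) : Prop where
  memLp_init : ∀ i, MemLp (fun ω => x₀ ω i) 2 μ
  memLp_noise : ∀ t i, MemLp (fun ω => w t ω i) 2 μ
  mean_init : ∀ i, ∫ ω, x₀ ω i ∂μ = 0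
  mean_noise : ∀ t i, ∫ ω, w t ω i ∂μ = 0
  cov_init : ∀ i j, ∫ ω, x₀ ω i * x₀ ω j ∂μ = if i = j then σx ^ 2 else 0
  cov_noise : ∀ t i j, ∫ ω, w t ω i * w t ω j ∂μ = if i = j then σw ^ 2 else 0
  uncorrelated_noise : ∀ s t, s ≠ t → ∀ i j, ∫ ω, w s ω i * w t ω j ∂μ = 0
  uncorrelated_init : ∀ t i j, ∫ ω, x₀ ω i * w t ω j ∂μ = 0

/-- The stage cost `xᵀ Q x + uᵀ R u`. -/
def stageCost {n m : ℕ} (Q : Matrix (Fin n) (Fin n) ℝ) (R : Matrix (Fin m) (Fin m) ℝ)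
    (x : Fin n → ℝ) (u : Fin m → ℝ) : ℝ :=
  x ⬝ᵥ Q *ᵥ x + u ⬝ᵥ R *ᵥ u

/-- The predicted state `x_{k|t}` of the model `(A, B)`, started at `x_{0|t} = x` and driven by the
inputs `u_{k|t} = u k` and the noise `w_{k+t}`. -/
def predState {n m : ℕ} {Ω : Type*} (A : Matrix (Fin n) (Fin n) ℝ)
    (B : Matrix (Fin n) (Fin m) ℝ) (w : ℕ → Ω → Fin n → ℝ) (t : ℕ) (x : Fin n → ℝ)
    (u : ℕ → Fin m → ℝ) : ℕ → Ω → Fin n → ℝ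
  | 0, _ => x
  | k + 1, ω => A *ᵥ predState A B w t x u k ω + B *ᵥ u k + w (k + t) ω

/-- The expected finite-horizon cost minimized at time `t` by the receding-horizon controller. Only
the inputs `u 0, …, u (N - 1)` enter. -/
def horizonCost {n m : ℕ} {Ω : Type*} [MeasurableSpace Ω] (μ : Measure Ω)
    (A : Matrix (Fin n) (Fin n) ℝ) (B : Matrix (Fin n) (Fin m) ℝ)
    (Q : Matrix (Fin n) (Fin n) ℝ) (R : Matrix (Fin m) (Fin m) ℝ)
    (P : Matrix (Fin n) (Fin n) ℝ) (N : ℕ) (w : ℕ → Ω → Fin n → ℝ) (t : ℕ) (x : Fin n → ℝ)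
    (u : ℕ → Fin m → ℝ) : ℝ :=
  ∫ ω, ((∑ k ∈ Finset.range N, stageCost Q R (predState A B w t x u k ω) (u k))
    + predState A B w t x u N ω ⬝ᵥ P *ᵥ predState A B w t x u N ω) ∂μ

/-- `κ` is a receding-horizon control law at time `t`: at every measured state `x` it applies the
first input of a minimizer of the expected finite-horizon cost. -/
def IsRecedingHorizonLaw {n m : ℕ} {Ω : Type*} [MeasurableSpace Ω] (μ : Measure Ω)
    (A : Matrix (Fin n) (Fin n) ℝ) (B : Matrix (Fin n) (Fin m) ℝ)
    (Q : Matrix (Fin n) (Fin n) ℝ) (R : Matrix (Fin m) (Fin m) ℝ)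
    (P : Matrix (Fin n) (Fin n) ℝ) (N : ℕ) (w : ℕ → Ω → Fin n → ℝ) (t : ℕ)
    (κ : (Fin n → ℝ) → Fin m → ℝ) : Prop :=
  ∀ x, ∃ u : ℕ → Fin m → ℝ,
    (∀ v : ℕ → Fin m → ℝ,
      horizonCost μ A B Q R P N w t x u ≤ horizonCost μ A B Q R P N w t x v) ∧
    κ x = u 0

/-- The state of `x_{t+1} = A x_t + B u_t + w_t` under the feedback `u_t = -K x_t`. -/
def closedLoopState {n m : ℕ} {Ω : Type*} (A : Matrix (Fin n) (Fin n) ℝ)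
    (B : Matrix (Fin n) (Fin m) ℝ) (K : Matrix (Fin m) (Fin n) ℝ) (x₀ : Ω → Fin n → ℝ)
    (w : ℕ → Ω → Fin n → ℝ) : ℕ → Ω → Fin n → ℝ
  | 0, ω => x₀ ω
  | t + 1, ω => A *ᵥ closedLoopState A B K x₀ w t ω
      + B *ᵥ (-(K *ᵥ closedLoopState A B K x₀ w t ω)) + w t ω

/-- The expected cost per time step of `u_t = -K x_t` over the first `T` steps. -/
def avgCost {n m : ℕ} {Ω : Type*} [MeasurableSpace Ω] (μ : Measure Ω)
    (A : Matrix (Fin n) (Fin n) ℝ) (B : Matrix (Fin n) (Fin m) ℝ)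
    (Q : Matrix (Fin n) (Fin n) ℝ) (R : Matrix (Fin m) (Fin m) ℝ)
    (x₀ : Ω → Fin n → ℝ) (w : ℕ → Ω → Fin n → ℝ) (K : Matrix (Fin m) (Fin n) ℝ) (T : ℕ) : ℝ :=
  1 / (T : ℝ) * ∫ ω, (∑ t ∈ Finset.range T,
    stageCost Q R (closedLoopState A B K x₀ w t ω) (-(K *ᵥ closedLoopState A B K x₀ w t ω))) ∂μ

/-- `J` is the average infinite-horizon cost `J_K` of the feedback `u_t = -K x_t`. -/
def HasAverageCost {n m : ℕ} {Ω : Type*} [MeasurableSpace Ω] (μ : Measure Ω)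
    (A : Matrix (Fin n) (Fin n) ℝ) (B : Matrix (Fin n) (Fin m) ℝ)
    (Q : Matrix (Fin n) (Fin n) ℝ) (R : Matrix (Fin m) (Fin m) ℝ)
    (x₀ : Ω → Fin n → ℝ) (w : ℕ → Ω → Fin n → ℝ) (K : Matrix (Fin m) (Fin n) ℝ) (J : ℝ) : Prop :=
  Tendsto (avgCost μ A B Q R x₀ w K) atTop (𝓝 J)

/-! ### The constants of the bound

In what follows `Υ` bounds the norms of the system matrices, `p` stands for `‖P⋆‖`, `β` for `β⋆`,
`εm` for the modeling error and `εp` for the terminal-cost error. -/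

/-- The smallest singular value of an `n × n` matrix (singular values are listed in decreasing
order, indexed from `0`). -/
def minSingularValue {n : ℕ} (M : Matrix (Fin n) (Fin n) ℝ) : ℝ :=
  (Matrix.toEuclideanLin M).singularValues (n - 1)

/-- `β⋆`, the largest singular value of `P⋆` divided by the smallest one of `Q`. -/
def betaStar {n : ℕ} (Q Pstar : Matrix (Fin n) (Fin n) ℝ) : ℝ :=
  ‖Pstar‖ / minSingularValue Q

/-- `ψ(εm, εp) = εm [1 + (εm + 2Υ)² (β εp + Υ)]`. -/
def psi (Υ β εm εp : ℝ) : ℝ :=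
  εm * (1 + (εm + 2 * Υ) ^ 2 * (β * εp + Υ))

/-- `γ₁(εm, εp) = √β ψ(εm, εp) + √(1 - β⁻¹)`. -/
def gamma₁ (Υ β εm εp : ℝ) : ℝ :=
  √β * psi Υ β εm εp + √(1 - β⁻¹)

/-- `α(εm) = (1 - 8 p² εm)^(-1/2)`. -/
def alpha (p εm : ℝ) : ℝ :=
  (1 - 8 * p ^ 2 * εm) ^ (-(1 / 2) : ℝ)

/-- `γ₂(εm) = √(1 - α(εm)⁻¹ β⁻¹)`. -/
def gamma₂ (p β εm : ℝ) : ℝ :=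
  √(1 - (alpha p εm)⁻¹ * β⁻¹)

/-- `ψ̃(εm) = (εm² + 2Υ εm) [Υ + (εm + Υ)² Υ²]`. -/
def psiTilde (Υ εm : ℝ) : ℝ :=
  (εm ^ 2 + 2 * Υ * εm) * (Υ + (εm + Υ) ^ 2 * Υ ^ 2)

/-- `Ê(εm, εp, i) = √α β {(γ₁γ₂)^i εp + ψ̃ (1 - (γ₁γ₂)^i) / (1 - γ₁γ₂)}`. -/
def errorBound (Υ p β εm εp : ℝ) (i : ℕ) : ℝ :=
  √(alpha p εm) * β *
    ((gamma₁ Υ β εm εp * gamma₂ p β εm) ^ i * εp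
      + psiTilde Υ εm *
        ((1 - (gamma₁ Υ β εm εp * gamma₂ p β εm) ^ i)
          / (1 - gamma₁ Υ β εm εp * gamma₂ p β εm)))

end

end LQ

namespace LQ

/-! ### Quadratic forms -/

/-! Errors of value functions are measured in the order generated by P⋆: F has relative error c if
|xᵀ(F - P⋆)x| ≤ c·xᵀP⋆x for all x. Completing the square (`bellman_eq`) makes a Riccati step the
minimum of a one-step cost, so two steps are compared by inserting the minimizer of one problem into
the other.

Put η = √(2‖P⋆‖)·εm. Since Q, R ⪰ I, the optimal stage cost bounds ‖x‖² + ‖u‖² by xᵀP⋆x, so the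
model error moves the next state by at most η in the P⋆-norm, relative to the current state. Hence
one step of the perturbed Riccati map moves P⋆ by a relative amount at most δ = 2η + η²
(`abs_riccati_perturbed_sub_le`), and its closed loop contracts P⋆ by (√(1 - β⁻¹) + η)²
(`closedLoop_perturbed_le`). For g at least this factor, relative errors obey c ↦ g·c + δ
(`abs_riccati_iterate_sub_le`). Scalar estimates show that g = γ₁γ₂ is admissible and less than one
and that ψ̃ dominates δ‖P⋆‖, so the iterate used by the controller has relative error at most Ê/‖P⋆‖
(`exists_riccati_iterate_le`).

Subtracting the first-order conditions of the two one-step problems makes the gain error linear in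
εm + c (`qf_gain_sub_le`). The cost excess is quadratic in it: by the Bellman equation it equals
tr(Dᵀ(R + BᵀP⋆B)D·X), where D is the gain error and X the stationary covariance
(`hasAverageCost_of_bellman`). P⋆ remains a Lyapunov function of the perturbed loop, which gives
stability and ‖X‖ ≤ 2β²σw² (`suboptimality`). -/

/-- The bilinear form `xᵀ P y`. -/
def bf {k : ℕ} (P : Matrix (Fin k) (Fin k) ℝ) (x y : Fin k → ℝ) : ℝ := x ⬝ᵥ P *ᵥ y

/-- The quadratic form `xᵀ P x`. -/
def qf {k : ℕ} (P : Matrix (Fin k) (Fin k) ℝ) (x : Fin k → ℝ) : ℝ := bf P x x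

section Forms

variable {k l : ℕ} (P P' : Matrix (Fin k) (Fin k) ℝ) (x y z : Fin k → ℝ) (t : ℝ)

lemma bf_add_left : bf P (x + y) z = bf P x z + bf P y z := by simp [bf]
lemma bf_add_right : bf P x (y + z) = bf P x y + bf P x z := by simp [bf, Matrix.mulVec_add]
lemma bf_sub_left : bf P (x - y) z = bf P x z - bf P y z := by simp [bf]
lemma bf_sub_right : bf P x (y - z) = bf P x y - bf P x z := by simp [bf, Matrix.mulVec_sub]
lemma bf_neg_left : bf P (-x) y = -bf P x y := by simp [bf]
lemma bf_neg_right : bf P x (-y) = -bf P x y := by simp [bf, Matrix.mulVec_neg]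
lemma bf_smul_left : bf P (t • x) y = t * bf P x y := by simp [bf]
lemma bf_smul_right : bf P x (t • y) = t * bf P x y := by simp [bf, Matrix.mulVec_smul]
lemma bf_mat_add : bf (P + P') x y = bf P x y + bf P' x y := by simp [bf, Matrix.add_mulVec]
lemma bf_mat_sub : bf (P - P') x y = bf P x y - bf P' x y := by simp [bf, Matrix.sub_mulVec]
lemma bf_mat_smul : bf (t • P) x y = t * bf P x y := by simp [bf, Matrix.smul_mulVec]

lemma bf_comm (hP : Pᵀ = P) : bf P x y = bf P y x := by
  rw [bf, dotProduct_comm, bf, ← Matrix.vecMul_transpose, hP, Matrix.dotProduct_mulVec]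

lemma bf_conj (M : Matrix (Fin k) (Fin l) ℝ) (u v : Fin l → ℝ) :
    bf (Mᵀ * P * M) u v = bf P (M *ᵥ u) (M *ᵥ v) := by
  simp only [bf, ← Matrix.mulVec_mulVec]
  rw [Matrix.dotProduct_mulVec, Matrix.vecMul_transpose]

lemma qf_conj (M : Matrix (Fin k) (Fin l) ℝ) (u : Fin l → ℝ) :
    qf (Mᵀ * P * M) u = qf P (M *ᵥ u) := bf_conj P M u u

lemma qf_one : qf (1 : Matrix (Fin k) (Fin k) ℝ) x = x ⬝ᵥ x := by simp [qf, bf]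

lemma qf_zero : qf P 0 = 0 := by simp [qf, bf]
lemma qf_smul : qf P (t • x) = t ^ 2 * qf P x := by
  simp only [qf, bf_smul_left, bf_smul_right]; ring
lemma qf_mat_sub : qf (P - P') x = qf P x - qf P' x := bf_mat_sub ..
lemma qf_mat_add : qf (P + P') x = qf P x + qf P' x := bf_mat_add ..
lemma qf_mat_smul : qf (t • P) x = t * qf P x := bf_mat_smul ..

variable {P P'}

lemma qf_add (hP : Pᵀ = P) : qf P (x + y) = qf P x + 2 * bf P x y + qf P y := by
  simp only [qf, bf_add_left, bf_add_right, bf_comm P y x hP]; ring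

lemma qf_sub (hP : Pᵀ = P) : qf P (x - y) = qf P x - 2 * bf P x y + qf P y := by
  simp only [qf, bf_sub_left, bf_sub_right, bf_comm P y x hP]; ring

lemma transpose_of_posSemidef (hP : P.PosSemidef) : Pᵀ = P := by
  simpa using hP.isHermitian.eq

lemma qf_nonneg (hP : P.PosSemidef) : 0 ≤ qf P x := by
  simpa [qf, bf] using hP.dotProduct_mulVec_nonneg x

lemma posSemidef_of_qf (hP : Pᵀ = P) (h : ∀ x, 0 ≤ qf P x) : P.PosSemidef :=
  Matrix.PosSemidef.of_dotProduct_mulVec_nonneg (by simpa [Matrix.IsHermitian] using hP)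
    (by simpa [qf, bf] using h)

lemma dot_self_nonneg : 0 ≤ x ⬝ᵥ x := by
  simpa [dotProduct] using Finset.sum_nonneg fun i _ => mul_self_nonneg (x i)

/-- Cauchy-Schwarz for a symmetric form dominated by another form. -/
lemma bf_sq_le {E : Matrix (Fin k) (Fin k) ℝ} {c : ℝ} (hE : Eᵀ = E) (hP : Pᵀ = P)
    (h : ∀ x, |qf E x| ≤ c * qf P x) : (bf E x y) ^ 2 ≤ c ^ 2 * qf P x * qf P y := by
  -- Polarization: combining the upper bound at `x + s • y` with the lower bound at `x - s • y`
  -- isolates the cross term, and a nonnegative quadratic in `s` has nonpositive discriminant.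
  have key : ∀ s : ℝ, 0 ≤ (c * qf P y) * (s * s) + (-(2 * bf E x y)) * s + c * qf P x := by
    intro s
    have h1 := (abs_le.1 (h (x + s • y))).2
    have h2 := (abs_le.1 (h (x - s • y))).1
    rw [qf_add _ _ hE, qf_add _ _ hP, qf_smul, qf_smul, bf_smul_right, bf_smul_right] at h1
    rw [qf_sub _ _ hE, qf_sub _ _ hP, qf_smul, qf_smul, bf_smul_right, bf_smul_right] at h2
    nlinarith
  have := discrim_le_zero key
  rw [discrim] at this
  nlinarith

lemma abs_bf_le {E : Matrix (Fin k) (Fin k) ℝ} {c a b : ℝ} (hE : Eᵀ = E)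
    (hP : P.PosSemidef) (hc : 0 ≤ c) (ha : 0 ≤ a) (hb : 0 ≤ b)
    (h : ∀ x, |qf E x| ≤ c * qf P x) (hx : qf P x ≤ a ^ 2) (hy : qf P y ≤ b ^ 2) :
    |bf E x y| ≤ c * a * b := by
  have hx0 := qf_nonneg x hP
  have hy0 := qf_nonneg y hP
  apply abs_le_of_sq_le_sq _ (by positivity)
  calc _ ≤ c ^ 2 * qf P x * qf P y := bf_sq_le x y hE (transpose_of_posSemidef hP) h
    _ ≤ c ^ 2 * a ^ 2 * b ^ 2 := by gcongr
    _ = _ := by ring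

/-- Cauchy-Schwarz. -/
lemma abs_bf_le_mul {a b : ℝ} (hP : P.PosSemidef) (ha : 0 ≤ a) (hb : 0 ≤ b)
    (hx : qf P x ≤ a ^ 2) (hy : qf P y ≤ b ^ 2) : |bf P x y| ≤ a * b := by
  have hT := transpose_of_posSemidef hP
  simpa using abs_bf_le x y hT hP zero_le_one ha hb
    (fun x => by rw [abs_of_nonneg (qf_nonneg x hP), one_mul]) hx hy

lemma qf_add_le {a b : ℝ} (hP : P.PosSemidef) (ha : 0 ≤ a) (hb : 0 ≤ b)
    (hx : qf P x ≤ a ^ 2) (hy : qf P y ≤ b ^ 2) : qf P (x + y) ≤ (a + b) ^ 2 := by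
  rw [qf_add _ _ (transpose_of_posSemidef hP)]
  have := (abs_le.1 (abs_bf_le_mul x y hP ha hb hx hy)).2
  nlinarith

lemma dot_eq_bf : x ⬝ᵥ y = bf 1 x y := by simp [bf]

end Forms

/-! ### Spectral norm -/

section Norms

variable {k l : ℕ}

lemma dot_self_eq_norm_sq (x : Fin k → ℝ) : x ⬝ᵥ x = ‖WithLp.toLp 2 x‖ ^ 2 := by
  rw [EuclideanSpace.norm_sq_eq]
  simp [dotProduct, sq]

lemma dot_mulVec_self_le (M : Matrix (Fin k) (Fin l) ℝ) (x : Fin l → ℝ) :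
    (M *ᵥ x) ⬝ᵥ (M *ᵥ x) ≤ ‖M‖ ^ 2 * (x ⬝ᵥ x) := by
  rw [dot_self_eq_norm_sq, dot_self_eq_norm_sq, ← mul_pow]
  exact pow_le_pow_left₀ (norm_nonneg _) (M.l2_opNorm_mulVec (WithLp.toLp 2 x)) 2

lemma abs_qf_le_norm (M : Matrix (Fin k) (Fin k) ℝ) (x : Fin k → ℝ) :
    |qf M x| ≤ ‖M‖ * (x ⬝ᵥ x) := by
  have h : |x ⬝ᵥ M *ᵥ x| ≤ √(x ⬝ᵥ x) * √((M *ᵥ x) ⬝ᵥ (M *ᵥ x)) := by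
    rw [dot_eq_bf]
    exact abs_bf_le_mul _ _ Matrix.PosSemidef.one (Real.sqrt_nonneg _) (Real.sqrt_nonneg _)
      (by rw [Real.sq_sqrt (dot_self_nonneg _), qf_one])
      (by rw [Real.sq_sqrt (dot_self_nonneg _), qf_one])
  refine h.trans ?_
  have h2 : √((M *ᵥ x) ⬝ᵥ (M *ᵥ x)) ≤ ‖M‖ * √(x ⬝ᵥ x) := by
    refine (Real.sqrt_le_sqrt (dot_mulVec_self_le M x)).trans ?_
    rw [Real.sqrt_mul (by positivity), Real.sqrt_sq (norm_nonneg _)]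
  calc _ ≤ √(x ⬝ᵥ x) * (‖M‖ * √(x ⬝ᵥ x)) := by gcongr
    _ = ‖M‖ * (√(x ⬝ᵥ x) * √(x ⬝ᵥ x)) := by ring
    _ = _ := by rw [Real.mul_self_sqrt (dot_self_nonneg _)]

lemma norm_le_of_dot_mulVec_le {M : Matrix (Fin k) (Fin l) ℝ} {c : ℝ} (hc : 0 ≤ c)
    (h : ∀ x, (M *ᵥ x) ⬝ᵥ (M *ᵥ x) ≤ c ^ 2 * (x ⬝ᵥ x)) : ‖M‖ ≤ c := by
  rw [Matrix.l2_opNorm_def]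
  refine ContinuousLinearMap.opNorm_le_bound _ hc fun x => ?_
  have h1 := h x.ofLp
  rw [dot_self_eq_norm_sq, dot_self_eq_norm_sq, ← mul_pow] at h1
  exact (pow_le_pow_iff_left₀ (norm_nonneg _) (by positivity) two_ne_zero).1 h1

end Norms

/-! ### Completing the square -/

section Riccati

variable {n m : ℕ} (A : Matrix (Fin n) (Fin n) ℝ) (B : Matrix (Fin n) (Fin m) ℝ)
  (Q : Matrix (Fin n) (Fin n) ℝ) {R : Matrix (Fin m) (Fin m) ℝ} {P : Matrix (Fin n) (Fin n) ℝ}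

lemma posDef_of_sub_one {k : ℕ} {M : Matrix (Fin k) (Fin k) ℝ} (h : (M - 1).PosSemidef) :
    M.PosDef := by
  simpa using Matrix.PosDef.posSemidef_add h Matrix.PosDef.one

lemma dot_self_le_qf {k : ℕ} {M : Matrix (Fin k) (Fin k) ℝ} (h : (M - 1).PosSemidef)
    (x : Fin k → ℝ) : x ⬝ᵥ x ≤ qf M x := by
  have := qf_nonneg x h
  rw [qf_mat_sub, qf_one] at this
  linarith

/-- `R + Bᵀ P B`. -/
def gramR (B : Matrix (Fin n) (Fin m) ℝ) (R : Matrix (Fin m) (Fin m) ℝ)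
    (P : Matrix (Fin n) (Fin n) ℝ) : Matrix (Fin m) (Fin m) ℝ := R + Bᵀ * P * B

lemma posSemidef_conj (hP : P.PosSemidef) : (Bᵀ * P * B).PosSemidef := by
  simpa using hP.conjTranspose_mul_mul_same B

lemma gramR_posDef (hR : R.PosDef) (hP : P.PosSemidef) : (gramR B R P).PosDef :=
  hR.add_posSemidef (posSemidef_conj B hP)

lemma bf_gramR (u v : Fin m → ℝ) :
    bf (gramR B R P) u v = bf R u v + bf P (B *ᵥ u) (B *ᵥ v) := by
  rw [gramR, bf_mat_add, bf_conj]

lemma qf_gramR (u : Fin m → ℝ) : qf (gramR B R P) u = qf R u + qf P (B *ᵥ u) := bf_gramR ..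

lemma gramR_mul_gain (hR : R.PosDef) (hP : P.PosSemidef) :
    gramR B R P * gain A B R P = Bᵀ * P * A := by
  have h : gain A B R P = (gramR B R P)⁻¹ * (Bᵀ * P * A) := by
    simp only [gain, gramR, Matrix.mul_assoc]
  rw [h, Matrix.mul_nonsing_inv_cancel_left _ _
    ((Matrix.isUnit_iff_isUnit_det _).1 (gramR_posDef B hR hP).isUnit)]

/-- The normal equation of the minimization in the Bellman operator. -/
lemma bf_gramR_gain (hR : R.PosDef) (hP : P.PosSemidef) (h : Fin m → ℝ) (x : Fin n → ℝ) :
    bf (gramR B R P) h (gain A B R P *ᵥ x) = bf P (B *ᵥ h) (A *ᵥ x) := by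
  rw [bf, Matrix.mulVec_mulVec, gramR_mul_gain A B hR hP, bf, ← Matrix.mulVec_mulVec,
    ← Matrix.mulVec_mulVec, Matrix.dotProduct_mulVec, Matrix.vecMul_transpose]

/-- The Woodbury identity in a form free of P⁻¹, hence valid for singular P ⪰ 0. It puts the Riccati
map in Schur complement form. -/
lemma inv_one_add_sMat_mul (hR : R.PosDef) (hP : P.PosSemidef) :
    (1 + sMat B R * P)⁻¹ = 1 - B * (gramR B R P)⁻¹ * Bᵀ * P := by
  apply Matrix.inv_eq_right_inv
  have hR1 : R⁻¹ * R = 1 :=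
    Matrix.nonsing_inv_mul _ ((Matrix.isUnit_iff_isUnit_det _).1 hR.isUnit)
  have hT : gramR B R P * (gramR B R P)⁻¹ = 1 := Matrix.mul_nonsing_inv _
    ((Matrix.isUnit_iff_isUnit_det _).1 (gramR_posDef B hR hP).isUnit)
  have h1 : Bᵀ * P * B = gramR B R P - R := by simp [gramR]
  set T := gramR B R P
  have h2 : sMat B R * P * (B * T⁻¹ * Bᵀ * P) = sMat B R * P - B * T⁻¹ * Bᵀ * P := by
    calc sMat B R * P * (B * T⁻¹ * Bᵀ * P)
        = B * R⁻¹ * (Bᵀ * P * B) * T⁻¹ * Bᵀ * P := by simp only [sMat, Matrix.mul_assoc]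
      _ = B * R⁻¹ * (T * T⁻¹) * Bᵀ * P - B * (R⁻¹ * R) * T⁻¹ * Bᵀ * P := by
        rw [h1]; simp only [Matrix.mul_sub, Matrix.sub_mul, Matrix.mul_assoc]
      _ = _ := by rw [hT, hR1, sMat, Matrix.mul_one, Matrix.mul_one]
  rw [add_mul, mul_sub, mul_sub, h2]
  simp

lemma riccati_eq (hR : R.PosDef) (hP : P.PosSemidef) :
    riccati A B Q R P = Aᵀ * P * A - (Bᵀ * P * A)ᵀ * (gramR B R P)⁻¹ * (Bᵀ * P * A) + Q := by
  rw [riccati, inv_one_add_sMat_mul B hR hP]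
  simp only [Matrix.transpose_mul, Matrix.transpose_transpose, transpose_of_posSemidef hP,
    Matrix.mul_sub, Matrix.sub_mul, Matrix.mul_assoc, Matrix.mul_one]

lemma riccati_transpose (hR : R.PosDef) (hP : P.PosSemidef) (hQ : Qᵀ = Q) :
    (riccati A B Q R P)ᵀ = riccati A B Q R P := by
  have hT := transpose_of_posSemidef (gramR_posDef B hR hP).posSemidef
  rw [riccati_eq A B Q hR hP]
  simp only [Matrix.transpose_add, Matrix.transpose_sub, Matrix.transpose_mul,
    Matrix.transpose_transpose, Matrix.transpose_nonsing_inv, hT, hQ, transpose_of_posSemidef hP,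
    Matrix.mul_assoc]

lemma qf_riccati (hR : R.PosDef) (hP : P.PosSemidef) (x : Fin n → ℝ) :
    qf (riccati A B Q R P) x
      = qf P (A *ᵥ x) - bf P (A *ᵥ x) (B *ᵥ (gain A B R P *ᵥ x)) + qf Q x := by
  have h1 : (Bᵀ * P * A)ᵀ * (gramR B R P)⁻¹ * (Bᵀ * P * A)
      = Aᵀ * P * (B * gain A B R P) := by
    rw [gain, gramR]
    simp only [Matrix.transpose_mul, Matrix.transpose_transpose, transpose_of_posSemidef hP,
      Matrix.mul_assoc]
  rw [riccati_eq A B Q hR hP, h1, qf_mat_add, qf_mat_sub, qf_conj]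
  congr 2
  rw [qf, bf, ← Matrix.mulVec_mulVec, ← Matrix.mulVec_mulVec, ← Matrix.mulVec_mulVec,
    Matrix.dotProduct_mulVec, Matrix.vecMul_transpose, bf]

/-- Completing the square in the Bellman operator. -/
theorem bellman_eq (hR : R.PosDef) (hP : P.PosSemidef) (x : Fin n → ℝ) (u : Fin m → ℝ) :
    qf Q x + qf R u + qf P (A *ᵥ x + B *ᵥ u)
      = qf (riccati A B Q R P) x + qf (gramR B R P) (u + gain A B R P *ᵥ x) := by
  have hPt := transpose_of_posSemidef hP
  have hT := transpose_of_posSemidef (gramR_posDef B hR hP).posSemidef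
  rw [qf_riccati A B Q hR hP, qf_add _ _ hT, qf_add _ _ hPt, bf_gramR_gain A B hR hP, qf_gramR]
  conv_rhs => rw [qf.eq_def (gramR B R P), bf_gramR_gain A B hR hP]
  rw [bf_comm P _ (A *ᵥ x) hPt, bf_comm P _ (A *ᵥ x) hPt]
  ring

/-- The square left over in `bellman_eq` is nonnegative, and zero for the optimal input
(`riccati_attained`). This pair carries all later comparisons of Riccati steps. -/
lemma riccati_le (hR : R.PosDef) (hP : P.PosSemidef) (x : Fin n → ℝ) (u : Fin m → ℝ) :
    qf (riccati A B Q R P) x ≤ qf Q x + qf R u + qf P (A *ᵥ x + B *ᵥ u) := by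
  rw [bellman_eq A B Q hR hP]
  have := qf_nonneg (u + gain A B R P *ᵥ x) (gramR_posDef B hR hP).posSemidef
  linarith

lemma riccati_attained (hR : R.PosDef) (hP : P.PosSemidef) (x : Fin n → ℝ) :
    qf (riccati A B Q R P) x = qf Q x + qf R (-(gain A B R P *ᵥ x))
      + qf P (A *ᵥ x + B *ᵥ (-(gain A B R P *ᵥ x))) := by
  rw [bellman_eq A B Q hR hP, neg_add_cancel, qf_zero, add_zero]

lemma riccati_posSemidef (hR : R.PosDef) (hQ : Q.PosSemidef) (hP : P.PosSemidef) :
    (riccati A B Q R P).PosSemidef := by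
  refine posSemidef_of_qf (riccati_transpose A B Q hR hP (transpose_of_posSemidef hQ)) fun x => ?_
  rw [riccati_attained A B Q hR hP]
  have h1 := qf_nonneg x hQ
  have h2 := qf_nonneg (-(gain A B R P *ᵥ x)) hR.posSemidef
  have h3 := qf_nonneg (A *ᵥ x + B *ᵥ (-(gain A B R P *ᵥ x))) hP
  linarith

lemma riccati_iterate_posSemidef (hR : R.PosDef) (hQ : Q.PosSemidef) (hP : P.PosSemidef) (i : ℕ) :
    ((riccati A B Q R)^[i] P).PosSemidef := by
  induction i with
  | zero => exact hP
  | succ i ih => rw [Function.iterate_succ_apply']; exact riccati_posSemidef A B Q hR hQ ih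

/-- The first-order optimality condition of the minimization in the Bellman operator. -/
lemma gain_stationary (hR : R.PosDef) (hP : P.PosSemidef) (h : Fin m → ℝ) (x : Fin n → ℝ) :
    bf R h (-(gain A B R P *ᵥ x))
      + bf P (B *ᵥ h) (A *ᵥ x + B *ᵥ (-(gain A B R P *ᵥ x))) = 0 := by
  have h1 := bf_gramR_gain A B hR hP h x
  rw [bf_gramR] at h1
  rw [Matrix.mulVec_neg, bf_add_right, bf_neg_right, bf_neg_right]
  linarith

end Riccati

/-! ### The smallest singular value -/

section SingularValue

variable {n : ℕ} {Q : Matrix (Fin n) (Fin n) ℝ}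

lemma minSingularValue_nonneg (Q : Matrix (Fin n) (Fin n) ℝ) : 0 ≤ minSingularValue Q :=
  LinearMap.singularValues_nonneg _ _

lemma toEuclideanLin_adjoint_comp (hQ : Qᵀ = Q) (v : EuclideanSpace ℝ (Fin n)) :
    ((Matrix.toEuclideanLin Q).adjoint ∘ₗ Matrix.toEuclideanLin Q) v
      = WithLp.toLp 2 (Q *ᵥ (Q *ᵥ v.ofLp)) := by
  rw [← Matrix.toEuclideanLin_conjTranspose_eq_adjoint, Matrix.conjTranspose_eq_transpose_of_trivial,
    hQ]
  simp [Matrix.toLpLin_apply]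

/-- The vector is also an eigenvector of QᵀQ = Q² with eigenvalue c², and the last singular value
squared is the smallest such eigenvalue. -/
lemma minSingularValue_sq_le_of_eigenvector (hn : 0 < n) (hQ : Qᵀ = Q) {v : Fin n → ℝ}
    (hv : v ≠ 0) {c : ℝ} (hc : Q *ᵥ v = c • v) : minSingularValue Q ^ 2 ≤ c ^ 2 := by
  have hfin : Module.finrank ℝ (EuclideanSpace ℝ (Fin n)) = n := by simp
  set T := Matrix.toEuclideanLin Q
  have hev : Module.End.HasEigenvalue (T.adjoint ∘ₗ T) (c ^ 2) := by
    refine Module.End.hasEigenvalue_of_hasEigenvector (x := WithLp.toLp 2 v)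
      ⟨Module.End.mem_eigenspace_iff.2 ?_, by simpa using hv⟩
    rw [toEuclideanLin_adjoint_comp hQ]
    simp only [hc, Matrix.mulVec_smul, smul_smul, sq]
    rfl
  obtain ⟨i, hi⟩ := T.isSymmetric_adjoint_comp_self.exists_eigenvalues_eq hfin hev
  rw [minSingularValue, LinearMap.sq_singularValues_of_lt _ hfin (Nat.sub_one_lt hn.ne')]
  have : T.isSymmetric_adjoint_comp_self.eigenvalues hfin i = c ^ 2 := by exact_mod_cast hi
  rw [← this]
  exact T.isSymmetric_adjoint_comp_self.eigenvalues_antitone hfin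
    (Fin.le_def.2 (Nat.le_sub_one_of_lt i.2))

lemma minSingularValue_mul_le_qf (hn : 0 < n) (hQ : Q.PosSemidef) (x : Fin n → ℝ) :
    minSingularValue Q * (x ⬝ᵥ x) ≤ qf Q x := by
  set s := minSingularValue Q
  have hQt := transpose_of_posSemidef hQ
  have hH : (Q - s • (1 : Matrix (Fin n) (Fin n) ℝ)).IsHermitian := by
    simp [Matrix.IsHermitian, hQt]
  have hps : (Q - s • (1 : Matrix (Fin n) (Fin n) ℝ)).PosSemidef := by
    rw [hH.posSemidef_iff_eigenvalues_nonneg]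
    intro i
    have h1 := hH.mulVec_eigenvectorBasis i
    set v : Fin n → ℝ := ⇑(hH.eigenvectorBasis i)
    have hv : v ≠ 0 := fun h => hH.eigenvectorBasis.orthonormal.ne_zero i (by
      ext j; exact congrFun h j)
    have h2 : Q *ᵥ v = (hH.eigenvalues i + s) • v := by
      rw [Matrix.sub_mulVec, Matrix.smul_mulVec, Matrix.one_mulVec, sub_eq_iff_eq_add] at h1
      rw [h1, add_smul]
    have h3 := minSingularValue_sq_le_of_eigenvector hn hQt hv h2
    have h4 : 0 ≤ (hH.eigenvalues i + s) * (v ⬝ᵥ v) := by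
      have := qf_nonneg v hQ
      rwa [qf, bf, h2, dotProduct_smul, smul_eq_mul] at this
    have h5 : 0 < v ⬝ᵥ v := lt_of_le_of_ne (dot_self_nonneg v)
      fun h => hv (dotProduct_self_eq_zero.1 h.symm)
    have h6 := nonneg_of_mul_nonneg_left h4 h5
    have h7 := abs_le_of_sq_le_sq h3 h6
    have h8 := le_abs_self (minSingularValue Q)
    show 0 ≤ hH.eigenvalues i
    linarith
  have := qf_nonneg x hps
  rw [qf_mat_sub, qf_mat_smul, qf_one] at this
  linarith

/-- For an eigenvector x of Q² at the eigenvalue σ², Cauchy-Schwarz gives ‖x‖² ≤ xᵀQx ≤ ‖x‖‖Qx‖ =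
σ‖x‖². -/
lemma one_le_minSingularValue (hn : 0 < n) (hQ : (Q - 1).PosSemidef) :
    1 ≤ minSingularValue Q := by
  have hfin : n - 1 < Module.finrank ℝ (EuclideanSpace ℝ (Fin n)) := by
    simpa using Nat.sub_one_lt hn.ne'
  have hQt := transpose_of_posSemidef (posDef_of_sub_one hQ).posSemidef
  obtain ⟨v, hv⟩ := (LinearMap.hasEigenvalue_adjoint_comp_self_sq_singularValues
    (Matrix.toEuclideanLin Q) hfin).exists_hasEigenvector
  have h1 := Module.End.mem_eigenspace_iff.1 hv.1
  rw [toEuclideanLin_adjoint_comp hQt] at h1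
  have h2 : Q *ᵥ (Q *ᵥ v.ofLp) = (minSingularValue Q ^ 2) • v.ofLp := congrArg WithLp.ofLp h1
  have h0 : v.ofLp ≠ 0 := fun h => hv.2 (by ext j; exact congrFun h j)
  set x : Fin n → ℝ := v.ofLp
  have hx : 0 < x ⬝ᵥ x := lt_of_le_of_ne (dot_self_nonneg x)
    fun h => h0 (dotProduct_self_eq_zero.1 h.symm)
  have h3 : bf Q x (Q *ᵥ x) = minSingularValue Q ^ 2 * (x ⬝ᵥ x) := by
    rw [bf, h2, dotProduct_smul, smul_eq_mul]
  have h4 : (Q *ᵥ x) ⬝ᵥ (Q *ᵥ x) = minSingularValue Q ^ 2 * (x ⬝ᵥ x) := by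
    rw [← h3, bf_comm _ _ _ hQt, bf]
  have h5 := bf_sq_le (E := 1) (P := 1) (c := 1) x (Q *ᵥ x) (by simp) (by simp) (fun y => by
    rw [qf_one, one_mul, abs_of_nonneg (dot_self_nonneg y)])
  rw [qf_one, qf_one, h4, ← dot_eq_bf] at h5
  have h6 : x ⬝ᵥ x ≤ x ⬝ᵥ Q *ᵥ x := dot_self_le_qf hQ x
  have h7 : (x ⬝ᵥ x) ^ 2 ≤ (x ⬝ᵥ Q *ᵥ x) ^ 2 := by gcongr
  have h8 : (x ⬝ᵥ x) ^ 2 * 1 ≤ (x ⬝ᵥ x) ^ 2 * minSingularValue Q ^ 2 := by linarith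
  have h9 := le_of_mul_le_mul_left h8 (by positivity)
  nlinarith [minSingularValue_nonneg Q]

end SingularValue

/-! ### Solutions of the algebraic Riccati equation -/

/-- `P` is a positive definite solution of the algebraic Riccati equation, with weights `Q, R ⪰ I`. -/
structure IsRiccatiSolution {n m : ℕ} (A : Matrix (Fin n) (Fin n) ℝ) (B : Matrix (Fin n) (Fin m) ℝ)
    (Q : Matrix (Fin n) (Fin n) ℝ) (R : Matrix (Fin m) (Fin m) ℝ)
    (P : Matrix (Fin n) (Fin n) ℝ) : Prop where
  dim_pos : 0 < n
  hR : (R - 1).PosSemidef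
  hQ : (Q - 1).PosSemidef
  hP : P.PosSemidef
  eq : P = riccati A B Q R P

namespace IsRiccatiSolution

variable {n m : ℕ} {A : Matrix (Fin n) (Fin n) ℝ} {B : Matrix (Fin n) (Fin m) ℝ}
  {Q : Matrix (Fin n) (Fin n) ℝ} {R : Matrix (Fin m) (Fin m) ℝ} {P : Matrix (Fin n) (Fin n) ℝ}

lemma R_posDef (S : IsRiccatiSolution A B Q R P) : R.PosDef := posDef_of_sub_one S.hR

lemma Q_posSemidef (S : IsRiccatiSolution A B Q R P) : Q.PosSemidef :=
  (posDef_of_sub_one S.hQ).posSemidef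

lemma qf_nonneg (S : IsRiccatiSolution A B Q R P) (x : Fin n → ℝ) : 0 ≤ qf P x :=
  LQ.qf_nonneg x S.hP

lemma bellman (S : IsRiccatiSolution A B Q R P) (x : Fin n → ℝ) :
    qf P x = qf Q x + qf R (-(gain A B R P *ᵥ x))
      + qf P (A *ᵥ x + B *ᵥ (-(gain A B R P *ᵥ x))) := by
  conv_lhs => rw [S.eq]
  exact riccati_attained A B Q S.R_posDef S.hP x

/-- Since Q, R ⪰ I, the optimal stage cost dominates ‖x‖² + ‖u‖². This makes model errors relative
to the value xᵀPx. -/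
lemma stage_le (S : IsRiccatiSolution A B Q R P) (x : Fin n → ℝ) :
    x ⬝ᵥ x + (-(gain A B R P *ᵥ x)) ⬝ᵥ (-(gain A B R P *ᵥ x)) ≤ qf P x := by
  rw [S.bellman]
  have h1 := dot_self_le_qf S.hQ x
  have h2 := dot_self_le_qf S.hR (-(gain A B R P *ᵥ x))
  have h3 := S.qf_nonneg (A *ᵥ x + B *ᵥ (-(gain A B R P *ᵥ x)))
  linarith

lemma qf_Q_le (S : IsRiccatiSolution A B Q R P) (x : Fin n → ℝ) : qf Q x ≤ qf P x := by
  rw [S.bellman]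
  have h2 := LQ.qf_nonneg (-(gain A B R P *ᵥ x)) S.R_posDef.posSemidef
  have h3 := S.qf_nonneg (A *ᵥ x + B *ᵥ (-(gain A B R P *ᵥ x)))
  linarith

lemma dot_le (S : IsRiccatiSolution A B Q R P) (x : Fin n → ℝ) : x ⬝ᵥ x ≤ qf P x :=
  (dot_self_le_qf S.hQ x).trans (S.qf_Q_le x)

lemma qf_le (x : Fin n → ℝ) : qf P x ≤ ‖P‖ * (x ⬝ᵥ x) :=
  (le_abs_self _).trans (abs_qf_le_norm P x)

lemma one_le_minSingularValue (S : IsRiccatiSolution A B Q R P) : 1 ≤ minSingularValue Q :=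
  LQ.one_le_minSingularValue S.dim_pos S.hQ

lemma minSingularValue_mul_le (S : IsRiccatiSolution A B Q R P) (x : Fin n → ℝ) :
    minSingularValue Q * (x ⬝ᵥ x) ≤ qf P x :=
  (minSingularValue_mul_le_qf S.dim_pos S.Q_posSemidef x).trans (S.qf_Q_le x)

lemma minSingularValue_le_norm (S : IsRiccatiSolution A B Q R P) : minSingularValue Q ≤ ‖P‖ := by
  have h := (S.minSingularValue_mul_le (Pi.single ⟨0, S.dim_pos⟩ 1)).trans (qf_le _)
  simpa using h

lemma one_le_norm (S : IsRiccatiSolution A B Q R P) : 1 ≤ ‖P‖ :=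
  S.one_le_minSingularValue.trans S.minSingularValue_le_norm

lemma one_le_betaStar (S : IsRiccatiSolution A B Q R P) : 1 ≤ betaStar Q P := by
  rw [betaStar, le_div_iff₀ (by linarith [S.one_le_minSingularValue]), one_mul]
  exact S.minSingularValue_le_norm

lemma betaStar_le_norm (S : IsRiccatiSolution A B Q R P) : betaStar Q P ≤ ‖P‖ :=
  div_le_self (norm_nonneg _) S.one_le_minSingularValue

/-- P ⪯ ‖P‖·I and σ_min(Q)·I ⪯ Q. So each step pays at least the fraction β⁻¹ of the current value.
-/
lemma inv_betaStar_mul_le (S : IsRiccatiSolution A B Q R P) (x : Fin n → ℝ) :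
    (betaStar Q P)⁻¹ * qf P x ≤ qf Q x := by
  have h1 := S.one_le_norm
  have h2 := minSingularValue_mul_le_qf S.dim_pos S.Q_posSemidef x
  have h3 := qf_le (P := P) x
  have h4 := S.one_le_minSingularValue
  rw [betaStar, inv_div, div_mul_eq_mul_div, div_le_iff₀ (by linarith)]
  nlinarith

/-- The optimal closed loop contracts the value function. -/
lemma qf_closedLoop_le (S : IsRiccatiSolution A B Q R P) (x : Fin n → ℝ) :
    qf P (A *ᵥ x + B *ᵥ (-(gain A B R P *ᵥ x))) ≤ (1 - (betaStar Q P)⁻¹) * qf P x := by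
  have h1 := S.bellman x
  have h2 := LQ.qf_nonneg (-(gain A B R P *ᵥ x)) S.R_posDef.posSemidef
  have h3 := S.inv_betaStar_mul_le x
  linarith

end IsRiccatiSolution

/-! ### Perturbation of the Riccati iteration -/

section Perturbation

variable {n m : ℕ} {A A' : Matrix (Fin n) (Fin n) ℝ} {B B' : Matrix (Fin n) (Fin m) ℝ}
  {Q : Matrix (Fin n) (Fin n) ℝ} {R : Matrix (Fin m) (Fin m) ℝ} {P : Matrix (Fin n) (Fin n) ℝ}
  {ε : ℝ}

lemma dot_mulVec_self_le_of_norm_le {k l : ℕ} {M : Matrix (Fin k) (Fin l) ℝ} {c : ℝ}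
    (h : ‖M‖ ≤ c) (x : Fin l → ℝ) : (M *ᵥ x) ⬝ᵥ (M *ᵥ x) ≤ c ^ 2 * (x ⬝ᵥ x) :=
  (dot_mulVec_self_le M x).trans
    (mul_le_mul_of_nonneg_right (pow_le_pow_left₀ (norm_nonneg _) h 2) (dot_self_nonneg x))

lemma dot_model_error_le (hA : ‖A' - A‖ ≤ ε) (hB : ‖B' - B‖ ≤ ε) (x : Fin n → ℝ)
    (u : Fin m → ℝ) :
    ((A' *ᵥ x + B' *ᵥ u) - (A *ᵥ x + B *ᵥ u)) ⬝ᵥ ((A' *ᵥ x + B' *ᵥ u) - (A *ᵥ x + B *ᵥ u))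
      ≤ 2 * ε ^ 2 * (x ⬝ᵥ x + u ⬝ᵥ u) := by
  have h1 := dot_mulVec_self_le_of_norm_le hA x
  have h2 := dot_mulVec_self_le_of_norm_le hB u
  have h3 : (A' *ᵥ x + B' *ᵥ u) - (A *ᵥ x + B *ᵥ u) = (A' - A) *ᵥ x + (B' - B) *ᵥ u := by
    rw [Matrix.sub_mulVec, Matrix.sub_mulVec]; abel
  have h4 := dot_self_nonneg ((A' - A) *ᵥ x - (B' - B) *ᵥ u)
  rw [h3]
  simp only [← qf_one] at h1 h2 h4 ⊢
  rw [qf_sub _ _ (by simp)] at h4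
  rw [qf_add _ _ (by simp)]
  linarith

lemma qf_model_error_le (hA : ‖A' - A‖ ≤ ε) (hB : ‖B' - B‖ ≤ ε) {x : Fin n → ℝ}
    {u : Fin m → ℝ} {v : ℝ} (h : x ⬝ᵥ x + u ⬝ᵥ u ≤ v ^ 2) :
    qf P ((A' *ᵥ x + B' *ᵥ u) - (A *ᵥ x + B *ᵥ u)) ≤ (√(2 * ‖P‖) * ε * v) ^ 2 := by
  refine (IsRiccatiSolution.qf_le _).trans ?_
  rw [mul_pow, mul_pow, Real.sq_sqrt (by positivity)]
  have := dot_model_error_le hA hB x u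
  calc _ ≤ ‖P‖ * (2 * ε ^ 2 * (x ⬝ᵥ x + u ⬝ᵥ u)) := by gcongr
    _ ≤ ‖P‖ * (2 * ε ^ 2 * v ^ 2) := by gcongr
    _ = _ := by ring

/-- Triangle inequality in the P-norm. The factor 2 under the root comes from ‖a + b‖² ≤ 2‖a‖² +
2‖b‖², with a and b the errors due to the state and to the input. -/
lemma qf_perturbed_le (hε : 0 ≤ ε) (hA : ‖A' - A‖ ≤ ε) (hB : ‖B' - B‖ ≤ ε) (hP : P.PosSemidef)
    {x : Fin n → ℝ} {u : Fin m → ℝ} {v a : ℝ} (hv : 0 ≤ v) (ha : 0 ≤ a)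
    (h : x ⬝ᵥ x + u ⬝ᵥ u ≤ v ^ 2) (h' : qf P (A *ᵥ x + B *ᵥ u) ≤ a ^ 2) :
    qf P (A' *ᵥ x + B' *ᵥ u) ≤ (a + √(2 * ‖P‖) * ε * v) ^ 2 := by
  have := qf_add_le _ _ hP ha (by positivity) h' (qf_model_error_le (P := P) hA hB h)
  rwa [add_sub_cancel] at this

namespace IsRiccatiSolution

lemma one_sub_inv_betaStar_nonneg (S : IsRiccatiSolution A B Q R P) :
    0 ≤ 1 - (betaStar Q P)⁻¹ :=
  sub_nonneg.2 (inv_le_one_of_one_le₀ S.one_le_betaStar)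

/-- One Riccati step of a perturbed model, from above. -/
lemma riccati_perturbed_le (S : IsRiccatiSolution A B Q R P) (hε : 0 ≤ ε) (hA : ‖A' - A‖ ≤ ε)
    (hB : ‖B' - B‖ ≤ ε) (x : Fin n → ℝ) :
    qf (riccati A' B' Q R P) x
      ≤ ((√(1 - (betaStar Q P)⁻¹) + √(2 * ‖P‖) * ε) ^ 2 + (betaStar Q P)⁻¹) * qf P x := by
  have hr := S.one_sub_inv_betaStar_nonneg
  have hV := S.qf_nonneg x
  -- The optimal input of the unperturbed model is a competitor in the perturbed problem.
  set u := -(gain A B R P *ᵥ x) with hu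
  set y := A *ᵥ x + B *ᵥ u with hy
  have h1 : qf (riccati A' B' Q R P) x ≤ qf Q x + qf R u + qf P (A' *ᵥ x + B' *ᵥ u) :=
    riccati_le A' B' Q S.R_posDef S.hP x u
  have h2 : qf P x = qf Q x + qf R u + qf P y := S.bellman x
  have h3 : qf P y ≤ (1 - (betaStar Q P)⁻¹) * qf P x := S.qf_closedLoop_le x
  have hy0 := S.qf_nonneg y
  have h4 : qf P (A' *ᵥ x + B' *ᵥ u) ≤ (√(qf P y) + √(2 * ‖P‖) * ε * √(qf P x)) ^ 2 :=
    qf_perturbed_le hε hA hB S.hP (Real.sqrt_nonneg _) (Real.sqrt_nonneg _)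
      (by rw [Real.sq_sqrt hV]; exact S.stage_le x) (by rw [Real.sq_sqrt hy0])
  have h5 : √(qf P y) ≤ √(1 - (betaStar Q P)⁻¹) * √(qf P x) := by
    rw [← Real.sqrt_mul hr]; exact Real.sqrt_le_sqrt h3
  have h6 : √(qf P y) * (√(2 * ‖P‖) * ε * √(qf P x))
      ≤ √(1 - (betaStar Q P)⁻¹) * √(qf P x) * (√(2 * ‖P‖) * ε * √(qf P x)) := by gcongr
  have h7 := Real.sq_sqrt hV
  have h8 := Real.sq_sqrt hy0
  have h9 := Real.sq_sqrt hr
  generalize √(2 * ‖P‖) * ε = η at *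
  generalize √(1 - (betaStar Q P)⁻¹) = r at *
  have h10 : (r * √(qf P x) * (η * √(qf P x))) = r * η * qf P x := by
    linear_combination r * η * h7
  have h11 : (η * √(qf P x)) ^ 2 = η ^ 2 * qf P x := by rw [mul_pow, h7]
  rw [add_sq, h8] at h4
  rw [add_sq, h9]
  nlinarith

/-- The stage cost takes at least β⁻¹·xᵀPx out of the perturbed value, which cancels the summand β⁻¹
in `riccati_perturbed_le`. -/
lemma closedLoop_perturbed_le (S : IsRiccatiSolution A B Q R P) (hε : 0 ≤ ε) (hA : ‖A' - A‖ ≤ ε)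
    (hB : ‖B' - B‖ ≤ ε) (x : Fin n → ℝ) :
    qf P (A' *ᵥ x + B' *ᵥ (-(gain A' B' R P *ᵥ x)))
      ≤ (√(1 - (betaStar Q P)⁻¹) + √(2 * ‖P‖) * ε) ^ 2 * qf P x := by
  have h1 := S.riccati_perturbed_le hε hA hB x
  have h2 := riccati_attained A' B' Q S.R_posDef S.hP x
  have h3 := LQ.qf_nonneg (-(gain A' B' R P *ᵥ x)) S.R_posDef.posSemidef
  have h4 := S.inv_betaStar_mul_le x
  linarith

/-- One Riccati step of a perturbed model, from below. -/
lemma le_riccati_perturbed (S : IsRiccatiSolution A B Q R P) (hε : 0 ≤ ε) (hA : ‖A' - A‖ ≤ ε)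
    (hB : ‖B' - B‖ ≤ ε) (x : Fin n → ℝ) :
    (1 - (2 * (√(2 * ‖P‖) * ε) + (√(2 * ‖P‖) * ε) ^ 2)) * qf P x
      ≤ qf (riccati A' B' Q R P) x := by
  have hV := S.qf_nonneg x
  have hη : 0 ≤ √(2 * ‖P‖) * ε := by positivity
  -- Roles exchanged: the perturbed minimizer competes in the unperturbed problem, so its stage cost
  -- is bounded by the perturbed value `W`.
  set u := -(gain A' B' R P *ᵥ x) with hu
  set y := A' *ᵥ x + B' *ᵥ u with hy
  set W := qf (riccati A' B' Q R P) x with hW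
  have h1 : qf P x ≤ qf Q x + qf R u + qf P (A *ᵥ x + B *ᵥ u) := by
    conv_lhs => rw [S.eq]
    exact riccati_le A B Q S.R_posDef S.hP x u
  have h2 : W = qf Q x + qf R u + qf P y := riccati_attained A' B' Q S.R_posDef S.hP x
  have h2a := dot_self_le_qf S.hQ x
  have h2b := dot_self_le_qf S.hR u
  have hy0 := S.qf_nonneg y
  have hx0 := dot_self_nonneg x
  have hu0 := dot_self_nonneg u
  have hW0 : 0 ≤ W := by linarith
  have h4 : qf P (A *ᵥ x + B *ᵥ u) ≤ (√(qf P y) + √(2 * ‖P‖) * ε * √W) ^ 2 :=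
    qf_perturbed_le hε (by rwa [norm_sub_rev]) (by rwa [norm_sub_rev]) S.hP (Real.sqrt_nonneg _)
      (Real.sqrt_nonneg _) (by rw [Real.sq_sqrt hW0]; linarith) (by rw [Real.sq_sqrt hy0])
  have h5 : √(qf P y) ≤ √W := Real.sqrt_le_sqrt (by linarith)
  have h7 := Real.sq_sqrt hW0
  have h8 := Real.sq_sqrt hy0
  generalize √(2 * ‖P‖) * ε = η at *
  have h6 : √(qf P y) * (η * √W) ≤ √W * (η * √W) := by gcongr
  have h10 : √W * (η * √W) = η * W := by linear_combination η * h7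
  have h11 : (η * √W) ^ 2 = η ^ 2 * W := by rw [mul_pow, h7]
  rw [add_sq, h8] at h4
  have h12 : qf P x ≤ W + (2 * η + η ^ 2) * W := by nlinarith
  -- From xᵀPx ≤ (1 + δ)W the claim (1 - δ)xᵀPx ≤ W is trivial if xᵀPx ≤ W, and otherwise δW ≤
  -- δ·xᵀPx.
  rcases le_total (qf P x) W with h | h
  · nlinarith [mul_nonneg (by positivity : 0 ≤ 2 * η + η ^ 2) hV]
  · nlinarith [mul_le_mul_of_nonneg_left h (by positivity : 0 ≤ 2 * η + η ^ 2)]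

lemma abs_riccati_perturbed_sub_le (S : IsRiccatiSolution A B Q R P) (hε : 0 ≤ ε)
    (hA : ‖A' - A‖ ≤ ε) (hB : ‖B' - B‖ ≤ ε) (x : Fin n → ℝ) :
    |qf (riccati A' B' Q R P) x - qf P x|
      ≤ (2 * (√(2 * ‖P‖) * ε) + (√(2 * ‖P‖) * ε) ^ 2) * qf P x := by
  have hV := S.qf_nonneg x
  have h1 := S.riccati_perturbed_le hε hA hB x
  have h2 := S.le_riccati_perturbed hε hA hB x
  have hr := S.one_sub_inv_betaStar_nonneg
  have h3 : √(1 - (betaStar Q P)⁻¹) ≤ 1 := by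
    have : 0 ≤ (betaStar Q P)⁻¹ := inv_nonneg.2 (by linarith [S.one_le_betaStar])
    exact Real.sqrt_le_iff.2 ⟨zero_le_one, by linarith⟩
  have h9 := Real.sq_sqrt hr
  have hη : 0 ≤ √(2 * ‖P‖) * ε := by positivity
  generalize √(2 * ‖P‖) * ε = η at *
  generalize √(1 - (betaStar Q P)⁻¹) = r at *
  rw [add_sq, h9] at h1
  rw [abs_le]
  have h4 : r * η * qf P x ≤ 1 * η * qf P x := by gcongr
  constructor <;> nlinarith

/-- The Riccati iterates of a perturbed model stay close to `P` in the order generated by `P`. -/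
lemma abs_riccati_iterate_sub_le (S : IsRiccatiSolution A B Q R P) {δ g c : ℝ}
    {P₀ : Matrix (Fin n) (Fin n) ℝ} (hδ : 0 ≤ δ) (hc : 0 ≤ c) (hg : 1 - (betaStar Q P)⁻¹ ≤ g)
    (hmodel : ∀ x, |qf (riccati A' B' Q R P) x - qf P x| ≤ δ * qf P x)
    (hloop : ∀ x, qf P (A' *ᵥ x + B' *ᵥ (-(gain A' B' R P *ᵥ x))) ≤ g * qf P x)
    (hP₀ : P₀.PosSemidef) (h₀ : ∀ x, |qf P₀ x - qf P x| ≤ c * qf P x) (i : ℕ) (x : Fin n → ℝ) :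
    |qf ((riccati A' B' Q R)^[i] P₀) x - qf P x|
      ≤ (g ^ i * c + δ * ∑ j ∈ Finset.range i, g ^ j) * qf P x := by
  have hg0 : 0 ≤ g := S.one_sub_inv_betaStar_nonneg.trans hg
  have hb0 : 0 ≤ (betaStar Q P)⁻¹ := inv_nonneg.2 (by linarith [S.one_le_betaStar])
  induction i generalizing x with
  | zero => simpa using h₀ x
  | succ i ih =>
    rw [Function.iterate_succ_apply']
    have hF := riccati_iterate_posSemidef A' B' Q S.R_posDef S.Q_posSemidef hP₀ i
    set F := (riccati A' B' Q R)^[i] P₀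
    have hci : 0 ≤ g ^ i * c + δ * ∑ j ∈ Finset.range i, g ^ j :=
      add_nonneg (by positivity) (mul_nonneg hδ (Finset.sum_nonneg fun j _ => by positivity))
    have hsucc : g ^ (i + 1) * c + δ * ∑ j ∈ Finset.range (i + 1), g ^ j
        = g * (g ^ i * c + δ * ∑ j ∈ Finset.range i, g ^ j) + δ := by
      rw [geom_sum_succ, pow_succ]; ring
    rw [hsucc]
    set a := g ^ i * c + δ * ∑ j ∈ Finset.range i, g ^ j
    have hV := S.qf_nonneg x
    have hm := abs_le.1 (hmodel x)
    have hQx := S.inv_betaStar_mul_le x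
    rw [abs_le]
    constructor
    -- For the lower bound the closed loop of `F` is not known to contract. The factor comes from
    -- the stage cost: with `d` = min(a, 1), the new value is at least (1 - d) times the perturbed
    -- Riccati image of P plus d·xᵀQx, and xᵀQx ≥ β⁻¹xᵀPx.
    · set u := -(gain A' B' R F *ᵥ x)
      set y := A' *ᵥ x + B' *ᵥ u
      have h1 : qf (riccati A' B' Q R F) x = qf Q x + qf R u + qf F y :=
        riccati_attained A' B' Q S.R_posDef hF x
      have h2 : qf (riccati A' B' Q R P) x ≤ qf Q x + qf R u + qf P y :=
        riccati_le A' B' Q S.R_posDef S.hP x u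
      have hy := S.qf_nonneg y
      have hRu := LQ.qf_nonneg u S.R_posDef.posSemidef
      -- Capping at 1 keeps 1 - d nonnegative; when a > 1 only F ⪰ 0 is used.
      obtain ⟨d, hd0, hd1, hda, hFy⟩ : ∃ d, 0 ≤ d ∧ d ≤ 1 ∧ d ≤ a ∧ (1 - d) * qf P y ≤ qf F y := by
        rcases le_total a 1 with ha | ha
        · refine ⟨a, hci, ha, le_rfl, ?_⟩
          linarith [(abs_le.1 (ih y)).1]
        · exact ⟨1, zero_le_one, le_rfl, ha, by simpa using LQ.qf_nonneg y hF⟩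
      have h3 : (1 - d) * (qf (riccati A' B' Q R P) x - qf Q x) ≤ (1 - d) * (qf R u + qf P y) :=
        mul_le_mul_of_nonneg_left (by linarith) (by linarith)
      have h4 : (1 - d) * ((1 - δ) * qf P x) ≤ (1 - d) * qf (riccati A' B' Q R P) x :=
        mul_le_mul_of_nonneg_left (by linarith) (by linarith)
      have h5 : d * (1 - (betaStar Q P)⁻¹) * qf P x ≤ a * g * qf P x := by
        gcongr
        exact S.one_sub_inv_betaStar_nonneg
      have h6 : 0 ≤ d * δ * qf P x := by positivity
      have h7 := mul_le_mul_of_nonneg_left hQx hd0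
      have h8 := mul_nonneg hd0 hRu
      nlinarith
    -- For the upper bound the minimizer for `P` competes in the problem for `F`, and `hloop`
    -- contracts the error at the next state.
    · set u := -(gain A' B' R P *ᵥ x)
      set y := A' *ᵥ x + B' *ᵥ u
      have h1 : qf (riccati A' B' Q R P) x = qf Q x + qf R u + qf P y :=
        riccati_attained A' B' Q S.R_posDef S.hP x
      have h2 : qf (riccati A' B' Q R F) x ≤ qf Q x + qf R u + qf F y :=
        riccati_le A' B' Q S.R_posDef hF x u
      have h3 := (abs_le.1 (ih y)).2
      have h4 : a * qf P y ≤ a * (g * qf P x) := mul_le_mul_of_nonneg_left (hloop x) hci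
      nlinarith

end IsRiccatiSolution

end Perturbation

/-! ### Estimates for the constants -/

section Constants

variable {Υ p β ε e : ℝ}

lemma one_le_alpha (hε : 0 ≤ ε) (h : 8 * p ^ 2 * ε ≤ 1 / 5) : 1 ≤ alpha p ε :=
  Real.one_le_rpow_of_pos_of_le_one_of_nonpos (by linarith)
    (by have : 0 ≤ 8 * p ^ 2 * ε := by positivity
        linarith) (by norm_num)

/-- √(1 - t) ≤ 1 - t/2 with t = 8p²ε. -/
lemma inv_alpha_le (h : 8 * p ^ 2 * ε ≤ 1 / 5) :
    (alpha p ε)⁻¹ ≤ 1 - 4 * p ^ 2 * ε := by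
  rw [alpha, ← Real.rpow_neg (by linarith), neg_neg, ← Real.sqrt_eq_rpow]
  refine Real.sqrt_le_iff.2 ⟨by linarith, ?_⟩
  nlinarith [sq_nonneg (4 * p ^ 2 * ε)]

lemma psi_nonneg (hΥ : 0 ≤ Υ) (hβ : 0 ≤ β) (hε : 0 ≤ ε) (he : 0 ≤ e) : 0 ≤ psi Υ β ε e := by
  unfold psi; positivity

lemma psiTilde_nonneg (hΥ : 0 ≤ Υ) (hε : 0 ≤ ε) : 0 ≤ psiTilde Υ ε := by
  unfold psiTilde; positivity

lemma gamma_mul_nonneg (hΥ : 0 ≤ Υ) (hβ : 0 ≤ β) (hε : 0 ≤ ε) (he : 0 ≤ e) :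
    0 ≤ gamma₁ Υ β ε e * gamma₂ p β ε := by
  have := psi_nonneg hΥ hβ hε he
  unfold gamma₁ gamma₂
  positivity

/-- Numerator and denominator have the same sign on both sides of 1 (at g = 1 the quotient is 0/0 =
0). Thus `errorBound` is nonnegative before γ₁γ₂ < 1 is known. -/
lemma geom_quot_nonneg {g : ℝ} (hg : 0 ≤ g) (i : ℕ) : 0 ≤ (1 - g ^ i) / (1 - g) := by
  rcases le_total g 1 with h | h
  · exact div_nonneg (sub_nonneg.2 (pow_le_one₀ hg h)) (sub_nonneg.2 h)
  · exact div_nonneg_of_nonpos (sub_nonpos.2 (one_le_pow₀ h)) (sub_nonpos.2 h)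

lemma errorBound_nonneg (hΥ : 0 ≤ Υ) (hβ : 0 ≤ β) (hε : 0 ≤ ε) (he : 0 ≤ e) (i : ℕ) :
    0 ≤ errorBound Υ p β ε e i := by
  have hg := gamma_mul_nonneg (p := p) hΥ hβ hε he
  have h1 := geom_quot_nonneg hg i
  have h2 := psiTilde_nonneg hΥ hε
  unfold errorBound
  positivity

/-- The left side is δ‖P⋆‖ for the one-step defect δ = 2η + η². Both sides compare with 4p²ε. -/
lemma psiTilde_ge (hp : 1 ≤ p) (hpΥ : p ≤ Υ) (hε : 0 ≤ ε) (hε' : ε ≤ 1 / 40) :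
    (2 * (√(2 * p) * ε) + (√(2 * p) * ε) ^ 2) * p ≤ psiTilde Υ ε := by
  have h1 : √(2 * p) ≤ 3 / 2 * p := Real.sqrt_le_iff.2 ⟨by linarith, by nlinarith⟩
  have h2 : √(2 * p) ^ 2 = 2 * p := Real.sq_sqrt (by linarith)
  have h3 : (2 * (√(2 * p) * ε) + (√(2 * p) * ε) ^ 2) * p ≤ 4 * p ^ 2 * ε := by
    rw [mul_pow, h2]
    have h4 : √(2 * p) * (ε * p) ≤ 3 / 2 * p * (ε * p) := by gcongr
    have h5 : ε * (ε * p ^ 2) ≤ 1 / 40 * (ε * p ^ 2) := by gcongr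
    have h6 : 0 ≤ ε * p ^ 2 := by positivity
    nlinarith
  refine h3.trans ?_
  have h7 : (2 * Υ * ε) * (Υ + Υ ^ 2 * Υ ^ 2) ≤ psiTilde Υ ε := by
    have hΥ : 0 ≤ Υ := by linarith
    have hΥε : Υ ≤ ε + Υ := by linarith
    unfold psiTilde
    gcongr
    nlinarith [sq_nonneg ε]
  refine le_trans ?_ h7
  have h8 : p * p ≤ Υ * Υ := by nlinarith
  have h9 : Υ * Υ * 1 ≤ Υ * Υ * Υ ^ 3 := by
    refine mul_le_mul_of_nonneg_left ?_ (mul_self_nonneg Υ)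
    exact one_le_pow₀ (by linarith)
  have h10 : 4 * p ^ 2 ≤ 2 * Υ * (Υ + Υ ^ 2 * Υ ^ 2) := by nlinarith
  calc _ = (4 * p ^ 2) * ε := by ring
    _ ≤ (2 * Υ * (Υ + Υ ^ 2 * Υ ^ 2)) * ε := mul_le_mul_of_nonneg_right h10 hε
    _ = _ := by ring

lemma sqrt_one_sub_le_gamma₂ (hβ : 1 ≤ β) (hε : 0 ≤ ε) (h : 8 * p ^ 2 * ε ≤ 1 / 5) :
    √(1 - β⁻¹) ≤ gamma₂ p β ε := by
  unfold gamma₂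
  apply Real.sqrt_le_sqrt
  have h1 : 0 ≤ β⁻¹ := by positivity
  have h2 : (alpha p ε)⁻¹ ≤ 1 := inv_le_one_of_one_le₀ (one_le_alpha hε h)
  nlinarith

/-- With r = √(1 - β⁻¹) and η = √(2p)·ε, it suffices that r ≤ γ₂, η ≤ γ₂ and r + 3η ≤ γ₁: then r² +
2rη + η² ≤ (r + 3η)γ₂. -/
lemma contraction_sq_le (hβ : 1 ≤ β) (hβp : β ≤ p) (hpΥ : p ≤ Υ) (hε : 0 ≤ ε) (he : 0 ≤ e)
    (h : 8 * p ^ 2 * ε ≤ 1 / 5) :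
    (√(1 - β⁻¹) + √(2 * p) * ε) ^ 2 ≤ gamma₁ Υ β ε e * gamma₂ p β ε := by
  have hp : 1 ≤ p := hβ.trans hβp
  have hΥ : 1 ≤ Υ := hp.trans hpΥ
  have hr := Real.sqrt_nonneg (1 - β⁻¹)
  have hγ := sqrt_one_sub_le_gamma₂ hβ hε h
  have hη0 : 0 ≤ √(2 * p) * ε := by positivity
  have hη2 : (√(2 * p) * ε) ^ 2 = 2 * p * ε ^ 2 := by rw [mul_pow, Real.sq_sqrt (by positivity)]
  have hε1 : ε ≤ 1 := by nlinarith [mul_le_mul_of_nonneg_right (one_le_pow₀ hp : 1 ≤ p ^ 2) hε]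
  -- Even at β = 1, where r = 0, the factor α⁻¹ ≤ 1 - 4p²ε leaves γ₂² ≥ 4p²ε·β⁻¹ ≥ 4pε ≥ 2pε².
  have hηγ : √(2 * p) * ε ≤ gamma₂ p β ε := by
    unfold gamma₂
    apply Real.le_sqrt_of_sq_le
    rw [hη2]
    have hb : β⁻¹ ≤ 1 := inv_le_one_of_one_le₀ hβ
    have hb0 : 0 ≤ β⁻¹ := by positivity
    have h2 := mul_le_mul_of_nonneg_right (inv_alpha_le h) hb0
    have h3 : p * β⁻¹ ≥ 1 := by rw [← div_eq_mul_inv, ge_iff_le, one_le_div (by linarith)]; exact hβp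
    have h4 : 4 * p * ε * 1 ≤ 4 * p * ε * (p * β⁻¹) := by gcongr
    have h5 : p * ε * ε ≤ p * ε * 1 := by gcongr
    have h6 : 0 ≤ p * ε := by positivity
    nlinarith
  have hγ₁ : √(1 - β⁻¹) + 3 * (√(2 * p) * ε) ≤ gamma₁ Υ β ε e := by
    unfold gamma₁
    have h1 : 3 * √(2 * p) ≤ 5 * Υ := by
      have : √(2 * p) ≤ 5 / 3 * Υ := Real.sqrt_le_iff.2 ⟨by linarith, by nlinarith⟩
      linarith
    have h2 : 5 * Υ ≤ 1 + (ε + 2 * Υ) ^ 2 * (β * e + Υ) := by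
      have h3 : (0 + 2 * Υ) ^ 2 * (0 + Υ) ≤ (ε + 2 * Υ) ^ 2 * (β * e + Υ) := by
        have : 0 ≤ β * e := by positivity
        gcongr
      -- The comparison 5Υ ≤ 1 + 4Υ³ is an equality at Υ = 1, hence the factorization.
      have h4 : 1 + 4 * Υ ^ 3 - 5 * Υ = (Υ - 1) * (4 * Υ ^ 2 + 4 * Υ - 1) := by ring
      have h5 : 0 ≤ (Υ - 1) * (4 * Υ ^ 2 + 4 * Υ - 1) :=
        mul_nonneg (by linarith) (by nlinarith)
      nlinarith
    have h3 : 3 * √(2 * p) * ε ≤ psi Υ β ε e := by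
      unfold psi
      rw [mul_comm ε]
      gcongr
      linarith
    have h4 : 1 * psi Υ β ε e ≤ √β * psi Υ β ε e := by
      gcongr
      · exact psi_nonneg (by linarith) (by linarith) hε he
      · exact Real.one_le_sqrt.2 hβ
    linarith
  generalize √(2 * p) * ε = η at *
  generalize √(1 - β⁻¹) = r at *
  have h1 : (r + 3 * η) * gamma₂ p β ε ≤ gamma₁ Υ β ε e * gamma₂ p β ε :=
    mul_le_mul_of_nonneg_right hγ₁ (hr.trans hγ)
  nlinarith [mul_le_mul_of_nonneg_left hγ hr, mul_le_mul_of_nonneg_left hγ hη0,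
    mul_le_mul_of_nonneg_left hηγ hη0]

lemma psi_le (hβ : 0 ≤ β) (hΥ : 1 ≤ Υ) (hε : 0 ≤ ε) (he : 0 ≤ e) (hε' : ε ≤ 1 / 40)
    (he' : β * e ≤ 1 / 40) : psi Υ β ε e ≤ 6 * Υ ^ 3 * ε := by
  unfold psi
  have h1 : ε + 2 * Υ ≤ 81 / 40 * Υ := by linarith
  have h2 : β * e + Υ ≤ 41 / 40 * Υ := by linarith
  have h3 : (1 : ℝ) ≤ Υ ^ 3 := one_le_pow₀ hΥ
  have h4 : (ε + 2 * Υ) ^ 2 * (β * e + Υ) ≤ (81 / 40 * Υ) ^ 2 * (41 / 40 * Υ) := by gcongr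
  have h5 : 1 + (ε + 2 * Υ) ^ 2 * (β * e + Υ) ≤ 6 * Υ ^ 3 := by nlinarith
  calc _ ≤ ε * (6 * Υ ^ 3) := by gcongr
    _ = _ := by ring

/-- The consequences of the smallness condition for the constants. -/
lemma modelError_le (hβ : 1 ≤ β) (hβp : β ≤ p) (hpΥ : p ≤ Υ) (hε : 0 ≤ ε) (he : 0 ≤ e) {i : ℕ}
    (hsmall : ε + errorBound Υ p β ε e i ≤ 1 / (40 * Υ ^ 4 * p ^ 2)) :
    40 * Υ ^ 4 * p ^ 2 * ε ≤ 1 ∧ 8 * p ^ 2 * ε ≤ 1 / 5 ∧ ε ≤ 1 / 40 := by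
  have hp : 1 ≤ p := hβ.trans hβp
  have hΥ : 1 ≤ Υ := hp.trans hpΥ
  have h0 := errorBound_nonneg (p := p) (by linarith : 0 ≤ Υ) (by linarith : 0 ≤ β) hε he i
  have h1 : 40 * Υ ^ 4 * p ^ 2 * ε ≤ 1 := by
    have : ε ≤ 1 / (40 * Υ ^ 4 * p ^ 2) := by linarith
    rw [le_div_iff₀ (by positivity)] at this
    linarith
  have h2 : (1 : ℝ) ≤ Υ ^ 4 := one_le_pow₀ hΥ
  have h3 : (1 : ℝ) ≤ p ^ 2 := one_le_pow₀ hp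
  have h4 : 1 * (40 * p ^ 2 * ε) ≤ Υ ^ 4 * (40 * p ^ 2 * ε) := by gcongr
  have h5 : 1 * (40 * ε) ≤ p ^ 2 * (40 * ε) := by gcongr
  exact ⟨h1, by linarith, by linarith⟩

/-- If γ₁γ₂ ≥ 1, its powers do not shrink the terminal error, so the smallness condition forces β·e
≤ 1/40. Then ψ ≤ 6Υ³ε gives √β·ψ < β⁻¹/2, while √(1 - β⁻¹) ≤ 1 - β⁻¹/2 and γ₂ ≤ 1, a contradiction.
-/
lemma gamma_mul_lt_one (hβ : 1 ≤ β) (hβp : β ≤ p) (hpΥ : p ≤ Υ) (hε : 0 ≤ ε) (he : 0 ≤ e) {i : ℕ}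
    (hsmall : ε + errorBound Υ p β ε e i ≤ 1 / (40 * Υ ^ 4 * p ^ 2)) :
    gamma₁ Υ β ε e * gamma₂ p β ε < 1 := by
  have hp : 1 ≤ p := hβ.trans hβp
  have hΥ : 1 ≤ Υ := hp.trans hpΥ
  obtain ⟨h1, h2, h3⟩ := modelError_le hβ hβp hpΥ hε he hsmall
  by_contra! hg
  have hα := one_le_alpha hε h2
  have h4 : β * e ≤ errorBound Υ p β ε e i := by
    unfold errorBound
    have h5 := geom_quot_nonneg (zero_le_one.trans hg) i
    have h6 := psiTilde_nonneg (by linarith : 0 ≤ Υ) hε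
    have h7 : 1 * e ≤ (gamma₁ Υ β ε e * gamma₂ p β ε) ^ i * e := by
      gcongr
      exact one_le_pow₀ hg
    have h8 : 1 * β * (1 * e) ≤ √(alpha p ε) * β * ((gamma₁ Υ β ε e * gamma₂ p β ε) ^ i * e) := by
      gcongr
      exact Real.one_le_sqrt.2 hα
    have h9 : 0 ≤ √(alpha p ε) * β * (psiTilde Υ ε *
        ((1 - (gamma₁ Υ β ε e * gamma₂ p β ε) ^ i) / (1 - gamma₁ Υ β ε e * gamma₂ p β ε))) := by
      positivity
    linarith
  have h5 : 1 / (40 * Υ ^ 4 * p ^ 2) ≤ 1 / 40 := by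
    have ha : (1 : ℝ) ≤ Υ ^ 4 := one_le_pow₀ hΥ
    have hb : (1 : ℝ) ≤ p ^ 2 := one_le_pow₀ hp
    apply one_div_le_one_div_of_le (by norm_num)
    nlinarith
  have h6 := psi_le (by linarith : 0 ≤ β) hΥ hε he h3 (by linarith)
  have hψ := psi_nonneg (by linarith : 0 ≤ Υ) (by linarith : 0 ≤ β) hε he
  have hγ₂ : gamma₂ p β ε ≤ 1 := by
    unfold gamma₂
    have : 0 ≤ (alpha p ε)⁻¹ * β⁻¹ := by positivity
    exact Real.sqrt_le_iff.2 ⟨zero_le_one, by linarith⟩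
  have hb0 : 0 ≤ β⁻¹ := by positivity
  have hr : √(1 - β⁻¹) ≤ 1 - β⁻¹ / 2 :=
    Real.sqrt_le_iff.2 ⟨by linarith [inv_le_one_of_one_le₀ hβ], by nlinarith [sq_nonneg β⁻¹]⟩
  have hsq : √β ≤ β := Real.sqrt_le_iff.2 ⟨by linarith, by nlinarith⟩
  have h7 : √β * psi Υ β ε e < β⁻¹ / 2 := by
    have h8 : √β * psi Υ β ε e * (2 * β) ≤ p * (6 * Υ ^ 3 * ε) * (2 * p) := by
      gcongr
      exact hsq.trans hβp
    have h9 : Υ ^ 3 * (p ^ 2 * ε) ≤ Υ ^ 4 * (p ^ 2 * ε) := by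
      exact mul_le_mul_of_nonneg_right (pow_le_pow_right₀ hΥ (by norm_num)) (by positivity)
    rw [inv_eq_one_div, div_div, lt_div_iff₀ (by positivity)]
    linarith [mul_comm (Υ ^ 4) (p ^ 2)]
  have hγ₁0 : 0 ≤ gamma₁ Υ β ε e := by unfold gamma₁; positivity
  have h8 : gamma₁ Υ β ε e * gamma₂ p β ε ≤ gamma₁ Υ β ε e * 1 := by gcongr
  unfold gamma₁ at h8 hg
  linarith

/-- Dropping √α ≥ 1 and summing the geometric series leaves the form produced by
`abs_riccati_iterate_sub_le`. -/
lemma errorBound_ge (hβ : 0 ≤ β) (hΥ : 0 ≤ Υ) (hε : 0 ≤ ε) (he : 0 ≤ e)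
    (h : 8 * p ^ 2 * ε ≤ 1 / 5) (hg : gamma₁ Υ β ε e * gamma₂ p β ε < 1) (i : ℕ) :
    β * ((gamma₁ Υ β ε e * gamma₂ p β ε) ^ i * e
      + psiTilde Υ ε * ∑ j ∈ Finset.range i, (gamma₁ Υ β ε e * gamma₂ p β ε) ^ j)
      ≤ errorBound Υ p β ε e i := by
  have hg0 := gamma_mul_nonneg (p := p) hΥ hβ hε he
  have h1 := psiTilde_nonneg hΥ hε
  unfold errorBound
  set g := gamma₁ Υ β ε e * gamma₂ p β ε
  have h2 : (1 - g ^ i) / (1 - g) = ∑ j ∈ Finset.range i, g ^ j := by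
    rw [geom_sum_eq hg.ne, ← neg_sub (g ^ i), ← neg_sub g, neg_div_neg_eq]
  rw [h2, mul_assoc]
  refine le_mul_of_one_le_left ?_ (Real.one_le_sqrt.2 (one_le_alpha hε h))
  have : 0 ≤ ∑ j ∈ Finset.range i, g ^ j := Finset.sum_nonneg fun j _ => by positivity
  positivity

end Constants

/-! ### Perturbation of the gain -/

section Gain

variable {n m : ℕ} {A A' : Matrix (Fin n) (Fin n) ℝ} {B B' : Matrix (Fin n) (Fin m) ℝ}
  {Q : Matrix (Fin n) (Fin n) ℝ} {R : Matrix (Fin m) (Fin m) ℝ} {P F : Matrix (Fin n) (Fin n) ℝ}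
  {ε c : ℝ}

namespace IsRiccatiSolution

/-- Sensitivity of the gain, in the norm generated by `R + Bᵀ P B`. -/
theorem qf_gain_sub_le (S : IsRiccatiSolution A B Q R P) (hε : 0 ≤ ε) (hA : ‖A' - A‖ ≤ ε)
    (hB : ‖B' - B‖ ≤ ε) (hε' : 8 * ‖P‖ ^ 2 * ε ≤ 1 / 5) (hc : 0 ≤ c) (hc' : c ≤ 1 / 40)
    (hF : F.PosSemidef) (hFP : ∀ x, |qf F x - qf P x| ≤ c * qf P x) (x : Fin n → ℝ) :
    qf (gramR B R P) (-(gain A' B' R F *ᵥ x) + gain A B R P *ᵥ x)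
      ≤ 9 * ‖P‖ * (ε + c) ^ 2 * qf P x := by
  have hp := S.one_le_norm
  have hV := S.qf_nonneg x
  set u := -(gain A' B' R F *ᵥ x) with hu
  set y' := A' *ᵥ x + B' *ᵥ u with hy'
  set y := A *ᵥ x + B *ᵥ u with hy
  set h := u + gain A B R P *ᵥ x with hh
  have hs0 : 0 ≤ qf (gramR B R P) h := LQ.qf_nonneg h (gramR_posDef B S.R_posDef S.hP).posSemidef
  have hsR : h ⬝ᵥ h ≤ qf (gramR B R P) h := by
    rw [qf_gramR]
    linarith [dot_self_le_qf S.hR h, S.qf_nonneg (B *ᵥ h)]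
  have hsP : qf P (B *ᵥ h) ≤ qf (gramR B R P) h := by
    rw [qf_gramR]
    linarith [LQ.qf_nonneg h S.R_posDef.posSemidef]
  have hη : √(2 * ‖P‖) * ε ≤ 3 / 2 * (√‖P‖ * ε) ∧ √(2 * ‖P‖) * ε ≤ 3 / 80 := by
    have h1 : √(2 * ‖P‖) ≤ 3 / 2 * √‖P‖ := by
      rw [Real.sqrt_mul (by norm_num)]
      gcongr
      exact Real.sqrt_le_iff.2 ⟨by norm_num, by norm_num⟩
    have h2 : √‖P‖ ≤ ‖P‖ ^ 2 := Real.sqrt_le_iff.2 ⟨by positivity, by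
      have h2a : (1 : ℝ) ≤ ‖P‖ ^ 3 := one_le_pow₀ hp
      nlinarith⟩
    have h3 := mul_le_mul_of_nonneg_right h1 hε
    have h4 := mul_le_mul_of_nonneg_right h2 hε
    constructor <;> nlinarith
  -- the value of the perturbed problem
  have hW : qf Q x + qf R u + qf F y' ≤ (11 / 10 * √(qf P x)) ^ 2 := by
    have h1 : qf (riccati A' B' Q R F) x = qf Q x + qf R u + qf F y' :=
      riccati_attained A' B' Q S.R_posDef hF x
    set u₁ := -(gain A' B' R P *ᵥ x)
    have h2 := riccati_le A' B' Q S.R_posDef hF x u₁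
    have h3 : qf (riccati A' B' Q R P) x = qf Q x + qf R u₁ + qf P (A' *ᵥ x + B' *ᵥ u₁) :=
      riccati_attained A' B' Q S.R_posDef S.hP x
    have h4 := (abs_le.1 (hFP (A' *ᵥ x + B' *ᵥ u₁))).2
    have h5 := (abs_le.1 (S.abs_riccati_perturbed_sub_le hε hA hB x)).2
    have h6 := LQ.qf_nonneg u₁ S.R_posDef.posSemidef
    have h7 := LQ.qf_nonneg x S.Q_posSemidef
    have h8 := S.qf_nonneg (A' *ᵥ x + B' *ᵥ u₁)
    have hη0 : 0 ≤ √(2 * ‖P‖) * ε := by positivity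
    have hη1 := hη.2
    generalize √(2 * ‖P‖) * ε = η at *
    have h9 : (2 * η + η ^ 2) * qf P x ≤ 8 / 100 * qf P x := by
      gcongr
      nlinarith
    have h10 : c * qf P (A' *ᵥ x + B' *ᵥ u₁) ≤ 1 / 40 * qf P (A' *ᵥ x + B' *ᵥ u₁) := by gcongr
    rw [mul_pow, Real.sq_sqrt hV]
    linarith
  have hQx := dot_self_le_qf S.hQ x
  have hRu := dot_self_le_qf S.hR u
  have hFy := LQ.qf_nonneg y' hF
  have hPy := S.qf_nonneg y'
  have hx0 := dot_self_nonneg x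
  have hu0 := dot_self_nonneg u
  have hv0 := Real.sqrt_nonneg (qf P x)
  have hv2 := Real.sq_sqrt hV
  have hs2 := Real.sq_sqrt hs0
  have hsn := Real.sqrt_nonneg (qf (gramR B R P) h)
  have hp0 := Real.sqrt_nonneg ‖P‖
  have hp2 := Real.sq_sqrt (norm_nonneg P)
  -- the first-order conditions of the two problems
  have hid : qf (gramR B R P) h
      = -bf P (B *ᵥ h) (y' - y) - bf (F - P) (B *ᵥ h) y' - bf F ((B' - B) *ᵥ h) y' := by
    have h1 := gain_stationary A B S.R_posDef S.hP h x
    have h2 := gain_stationary A' B' S.R_posDef hF h x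
    rw [← hu, ← hy'] at h2
    have h3 : qf (gramR B R P) h = bf (gramR B R P) h (u - -(gain A B R P *ᵥ x)) := by
      rw [sub_neg_eq_add, ← hh, qf]
    rw [h3, bf_sub_right, bf_gramR, bf_gramR, bf_mat_sub, bf_sub_right, Matrix.sub_mulVec,
      bf_sub_left, hy]
    simp only [bf_add_right] at h1 ⊢
    linarith
  -- The three terms of `hid` carry the errors of the next state, of the value function and of the
  -- input matrix. Each is linear in the size s of `h`, so s² is bounded by s times the error.
  have hT1 : |bf P (B *ᵥ h) (y' - y)| ≤ √(qf (gramR B R P) h)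
      * (√(2 * ‖P‖) * ε * (11 / 10 * √(qf P x))) :=
    abs_bf_le_mul _ _ S.hP hsn (by positivity) (by rwa [hs2])
      (qf_model_error_le hA hB (by linarith))
  have hT2 : |bf (F - P) (B *ᵥ h) y'| ≤ c * √(qf (gramR B R P) h) * (6 / 5 * √(qf P x)) := by
    refine abs_bf_le _ _ ?_ S.hP hc hsn (by positivity)
      (fun z => by rw [qf_mat_sub]; exact hFP z) (by rwa [hs2]) ?_
    · rw [Matrix.transpose_sub, transpose_of_posSemidef hF, transpose_of_posSemidef S.hP]
    · have h1 := (abs_le.1 (hFP y')).1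
      have h2 : c * qf P y' ≤ 1 / 40 * qf P y' := by gcongr
      rw [mul_pow, hv2] at hW ⊢
      linarith
  have hT3 : |bf F ((B' - B) *ᵥ h) y'|
      ≤ (11 / 10 * (√‖P‖ * ε) * √(qf (gramR B R P) h)) * (11 / 10 * √(qf P x)) := by
    refine abs_bf_le_mul _ _ hF (by positivity) (by positivity) ?_ (by linarith)
    have h1 := (abs_le.1 (hFP ((B' - B) *ᵥ h))).2
    have h2 := qf_le (P := P) ((B' - B) *ᵥ h)
    have h3 := dot_mulVec_self_le_of_norm_le hB h
    have h4 : ‖P‖ * (((B' - B) *ᵥ h) ⬝ᵥ ((B' - B) *ᵥ h))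
        ≤ ‖P‖ * (ε ^ 2 * qf (gramR B R P) h) := by
      gcongr
      exact h3.trans (by gcongr)
    have h5 : c * qf P ((B' - B) *ᵥ h) ≤ 1 / 40 * qf P ((B' - B) *ᵥ h) := by
      gcongr
      exact S.qf_nonneg _
    rw [mul_pow, mul_pow, mul_pow, hs2, hp2]
    have h6 : 0 ≤ ‖P‖ * (ε ^ 2 * qf (gramR B R P) h) := by positivity
    linarith
  have hp1 : 1 ≤ √‖P‖ := Real.one_le_sqrt.2 hp
  -- The coefficient of √‖P‖·ε is 33/20 + 121/100 and that of c is 6/5; both are below 3.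
  have hsle : √(qf (gramR B R P) h) ≤ 3 * √‖P‖ * (ε + c) * √(qf P x) := by
    rcases hsn.eq_or_lt with h0 | h0
    · rw [← h0]; positivity
    refine le_of_mul_le_mul_left ?_ h0
    have h1 : √(qf (gramR B R P) h) * √(qf (gramR B R P) h) = qf (gramR B R P) h := by
      rw [← sq, hs2]
    have h2 := (abs_le.1 hT1).1
    have h3 := (abs_le.1 hT2).1
    have h4 := (abs_le.1 hT3).1
    have h5 : √(qf (gramR B R P) h) * (√(2 * ‖P‖) * ε * (11 / 10 * √(qf P x)))
        ≤ √(qf (gramR B R P) h) * (3 / 2 * (√‖P‖ * ε) * (11 / 10 * √(qf P x))) := by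
      gcongr ?_ * (?_ * ?_)
      exact hη.1
    rw [h1]
    generalize √(qf (gramR B R P) h) = s at *
    generalize √(qf P x) = v at *
    have h6 : 1 * (c * s * v) ≤ √‖P‖ * (c * s * v) := by gcongr
    have h7 : 0 ≤ √‖P‖ * ε * s * v := by positivity
    have h8 : 0 ≤ c * s * v := by positivity
    nlinarith
  calc qf (gramR B R P) h = √(qf (gramR B R P) h) ^ 2 := hs2.symm
    _ ≤ (3 * √‖P‖ * (ε + c) * √(qf P x)) ^ 2 := by gcongr
    _ = _ := by rw [mul_pow, mul_pow, mul_pow, hv2, hp2]; ring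

end IsRiccatiSolution

end Gain

/-! ### Lyapunov functions -/

section Lyapunov

variable {n : ℕ} {P M : Matrix (Fin n) (Fin n) ℝ} {θ : ℝ}

/-- For a complex eigenvector a + ib, adding the contraction inequalities for a and b cancels the
cross terms and leaves |z|²(aᵀPa + bᵀPb) ≤ θ(aᵀPa + bᵀPb). -/
lemma isSchurStable_of_contraction (hP : P.PosDef) (hθ : θ < 1)
    (h : ∀ x, qf P (M *ᵥ x) ≤ θ * qf P x) : IsSchurStable M := by
  intro z hz
  set Mc := M.map (fun r : ℝ => (r : ℂ))
  rw [← Matrix.spectrum_toLin', ← Module.End.hasEigenvalue_iff_mem_spectrum] at hz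
  obtain ⟨v, hv⟩ := hz.exists_hasEigenvector
  have h1 : Mc *ᵥ v = z • v := by
    simpa using Module.End.mem_eigenspace_iff.1 hv.1
  set a : Fin n → ℝ := fun i => (v i).re
  set b : Fin n → ℝ := fun i => (v i).im
  have ha : M *ᵥ a = z.re • a - z.im • b := by
    ext i
    have := congrArg Complex.re (congrFun h1 i)
    simpa [Matrix.mulVec, dotProduct, Mc, a, b] using this
  have hb : M *ᵥ b = z.re • b + z.im • a := by
    ext i
    have := congrArg Complex.im (congrFun h1 i)
    simpa [Matrix.mulVec, dotProduct, Mc, a, b] using this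
  have hPt := transpose_of_posSemidef hP.posSemidef
  have h2 := h a
  have h3 := h b
  rw [ha, qf_sub _ _ hPt, qf_smul, qf_smul, bf_smul_left, bf_smul_right] at h2
  rw [hb, qf_add _ _ hPt, qf_smul, qf_smul, bf_smul_left, bf_smul_right, bf_comm P b a hPt] at h3
  have hab : 0 < qf P a + qf P b := by
    have hpos : ∀ x : Fin n → ℝ, x ≠ 0 → 0 < qf P x := fun x hx => by
      simpa [qf, bf] using hP.dotProduct_mulVec_pos hx
    by_cases ha0 : a = 0
    · have hb0 : b ≠ 0 := fun hb0 => hv.2 (by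
        ext i
        exact Complex.ext (congrFun ha0 i) (congrFun hb0 i))
      linarith [hpos b hb0, LQ.qf_nonneg a hP.posSemidef]
    · linarith [hpos a ha0, LQ.qf_nonneg b hP.posSemidef]
  have h4 : (z.re ^ 2 + z.im ^ 2) * (qf P a + qf P b) ≤ θ * (qf P a + qf P b) := by nlinarith
  have h5 := le_of_mul_le_mul_right h4 hab
  have h6 : ‖z‖ ^ 2 < 1 := by
    rw [← Complex.normSq_eq_norm_sq, Complex.normSq_apply]
    nlinarith
  nlinarith [norm_nonneg z]

lemma qf_pow_mulVec_le (hθ : 0 ≤ θ) (h : ∀ x, qf P (M *ᵥ x) ≤ θ * qf P x) (k : ℕ)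
    (x : Fin n → ℝ) : qf P (M ^ k *ᵥ x) ≤ θ ^ k * qf P x := by
  induction k with
  | zero => simp
  | succ k ih =>
    rw [pow_succ', ← Matrix.mulVec_mulVec, pow_succ']
    have := mul_le_mul_of_nonneg_left ih hθ
    linarith [h (M ^ k *ᵥ x)]

lemma norm_pow_sq_le {ℓ : ℝ} (hℓ : 0 < ℓ) (hP : ∀ x, ℓ * (x ⬝ᵥ x) ≤ qf P x) (hθ : 0 ≤ θ)
    (h : ∀ x, qf P (M *ᵥ x) ≤ θ * qf P x) (k : ℕ) : ‖M ^ k‖ ^ 2 ≤ ‖P‖ / ℓ * θ ^ k := by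
  have h0 : 0 ≤ ‖P‖ / ℓ * θ ^ k := by positivity
  have h1 : ‖M ^ k‖ ≤ √(‖P‖ / ℓ * θ ^ k) := by
    refine norm_le_of_dot_mulVec_le (Real.sqrt_nonneg _) fun x => ?_
    rw [Real.sq_sqrt h0]
    have h2 := hP (M ^ k *ᵥ x)
    have h3 := qf_pow_mulVec_le hθ h k x
    have h4 : θ ^ k * qf P x ≤ θ ^ k * (‖P‖ * (x ⬝ᵥ x)) := by
      gcongr
      exact IsRiccatiSolution.qf_le x
    rw [div_mul_eq_mul_div, div_mul_eq_mul_div, le_div_iff₀ hℓ]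
    linarith
  calc _ ≤ √(‖P‖ / ℓ * θ ^ k) ^ 2 := by gcongr
    _ = _ := Real.sq_sqrt h0

end Lyapunov

/-! ### Second moments -/

section Moments

variable {Ω : Type*} [MeasurableSpace Ω] {μ : Measure Ω} {k l q : ℕ}

/-- The matrix `E(y zᵀ)`. -/
noncomputable def crossCov (μ : Measure Ω) (y : Ω → Fin k → ℝ) (z : Ω → Fin l → ℝ) :
    Matrix (Fin k) (Fin l) ℝ :=
  Matrix.of fun i j => ∫ ω, y ω i * z ω j ∂μ

lemma crossCov_apply (y : Ω → Fin k → ℝ) (z : Ω → Fin l → ℝ) (i : Fin k) (j : Fin l) :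
    crossCov μ y z i j = ∫ ω, y ω i * z ω j ∂μ := rfl

lemma crossCov_transpose (y : Ω → Fin k → ℝ) (z : Ω → Fin l → ℝ) :
    (crossCov μ y z)ᵀ = crossCov μ z y := by
  ext i j
  simp only [Matrix.transpose_apply, crossCov_apply, mul_comm]

lemma memLp_mulVec {y : Ω → Fin k → ℝ} (hy : ∀ i, MemLp (fun ω => y ω i) 2 μ)
    (M : Matrix (Fin l) (Fin k) ℝ) (i : Fin l) : MemLp (fun ω => (M *ᵥ y ω) i) 2 μ := by
  simp only [Matrix.mulVec, dotProduct]
  exact memLp_finsetSum _ fun j _ => (hy j).const_mul _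

variable {y y' : Ω → Fin k → ℝ} {z z' : Ω → Fin l → ℝ}

lemma integrable_mul_apply (hy : ∀ i, MemLp (fun ω => y ω i) 2 μ)
    (hz : ∀ i, MemLp (fun ω => z ω i) 2 μ) (i : Fin k) (j : Fin l) :
    Integrable (fun ω => y ω i * z ω j) μ := (hy i).integrable_mul (hz j)

lemma crossCov_add_left (hy : ∀ i, MemLp (fun ω => y ω i) 2 μ)
    (hy' : ∀ i, MemLp (fun ω => y' ω i) 2 μ) (hz : ∀ i, MemLp (fun ω => z ω i) 2 μ) :
    crossCov μ (fun ω => y ω + y' ω) z = crossCov μ y z + crossCov μ y' z := by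
  ext i j
  simp only [Matrix.add_apply, crossCov_apply, Pi.add_apply, add_mul]
  exact integral_add (integrable_mul_apply hy hz i j) (integrable_mul_apply hy' hz i j)

lemma crossCov_add_right (hy : ∀ i, MemLp (fun ω => y ω i) 2 μ)
    (hz : ∀ i, MemLp (fun ω => z ω i) 2 μ) (hz' : ∀ i, MemLp (fun ω => z' ω i) 2 μ) :
    crossCov μ y (fun ω => z ω + z' ω) = crossCov μ y z + crossCov μ y z' := by
  rw [← crossCov_transpose, crossCov_add_left hz hz' hy, Matrix.transpose_add, crossCov_transpose,
    crossCov_transpose]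

lemma crossCov_mulVec_left (hy : ∀ i, MemLp (fun ω => y ω i) 2 μ)
    (hz : ∀ i, MemLp (fun ω => z ω i) 2 μ) (M : Matrix (Fin q) (Fin k) ℝ) :
    crossCov μ (fun ω => M *ᵥ y ω) z = M * crossCov μ y z := by
  ext i j
  simp only [Matrix.mul_apply, crossCov_apply, Matrix.mulVec, dotProduct, Finset.sum_mul]
  rw [integral_finsetSum]
  · simp only [mul_assoc, integral_const_mul]
  · intro r _
    simp only [mul_assoc]
    exact (integrable_mul_apply hy hz r j).const_mul _

lemma crossCov_mulVec_right (hy : ∀ i, MemLp (fun ω => y ω i) 2 μ)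
    (hz : ∀ i, MemLp (fun ω => z ω i) 2 μ) (M : Matrix (Fin q) (Fin l) ℝ) :
    crossCov μ y (fun ω => M *ᵥ z ω) = crossCov μ y z * Mᵀ := by
  rw [← crossCov_transpose, crossCov_mulVec_left hz hy, Matrix.transpose_mul, crossCov_transpose]

lemma qf_eq_sum (G : Matrix (Fin k) (Fin k) ℝ) (x : Fin k → ℝ) :
    qf G x = ∑ i, ∑ j, G i j * (x j * x i) := by
  simp only [qf, bf, dotProduct, Matrix.mulVec, Finset.mul_sum]
  exact Finset.sum_congr rfl fun i _ => Finset.sum_congr rfl fun j _ => by ring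

lemma integrable_qf (hy : ∀ i, MemLp (fun ω => y ω i) 2 μ) (G : Matrix (Fin k) (Fin k) ℝ) :
    Integrable (fun ω => qf G (y ω)) μ := by
  simp only [qf_eq_sum]
  exact integrable_finsetSum _ fun i _ => integrable_finsetSum _ fun j _ =>
    (integrable_mul_apply hy hy j i).const_mul _

lemma integral_qf (hy : ∀ i, MemLp (fun ω => y ω i) 2 μ) (G : Matrix (Fin k) (Fin k) ℝ) :
    ∫ ω, qf G (y ω) ∂μ = (G * crossCov μ y y).trace := by
  simp only [qf_eq_sum, Matrix.trace, Matrix.diag, Matrix.mul_apply, crossCov_apply]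
  refine (integral_finsetSum _ fun i _ => integrable_finsetSum _ fun j _ =>
    (integrable_mul_apply hy hy j i).const_mul _).trans (Finset.sum_congr rfl fun i _ => ?_)
  exact (integral_finsetSum _ fun j _ => (integrable_mul_apply hy hy j i).const_mul _).trans
    (Finset.sum_congr rfl fun j _ => integral_const_mul _ _)

lemma integrable_dot [IsFiniteMeasure μ] (hy : ∀ i, MemLp (fun ω => y ω i) 2 μ)
    (a : Fin k → ℝ) : Integrable (fun ω => a ⬝ᵥ y ω) μ := by
  simp only [dotProduct]
  exact integrable_finsetSum _ fun i _ => ((hy i).integrable one_le_two).const_mul _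

lemma integral_dot_eq_zero [IsFiniteMeasure μ] (hy : ∀ i, MemLp (fun ω => y ω i) 2 μ)
    (hy0 : ∀ i, ∫ ω, y ω i ∂μ = 0) (a : Fin k → ℝ) : ∫ ω, a ⬝ᵥ y ω ∂μ = 0 := by
  simp only [dotProduct]
  rw [integral_finsetSum _ fun i _ => ((hy i).integrable one_le_two).const_mul _]
  simp [integral_const_mul, hy0]

lemma integral_qf_const_add [IsProbabilityMeasure μ] (hy : ∀ i, MemLp (fun ω => y ω i) 2 μ)
    (hy0 : ∀ i, ∫ ω, y ω i ∂μ = 0) {G : Matrix (Fin k) (Fin k) ℝ} (hG : Gᵀ = G)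
    (a : Fin k → ℝ) :
    Integrable (fun ω => qf G (a + y ω)) μ ∧
      ∫ ω, qf G (a + y ω) ∂μ = qf G a + ∫ ω, qf G (y ω) ∂μ := by
  have h1 : ∀ ω, qf G (a + y ω) = qf G a + 2 * ((a ᵥ* G) ⬝ᵥ y ω) + qf G (y ω) := fun ω => by
    rw [qf_add _ _ hG, bf, Matrix.dotProduct_mulVec]
  have h2 : Integrable (fun ω => qf G a + 2 * ((a ᵥ* G) ⬝ᵥ y ω)) μ :=
    (integrable_const _).add ((integrable_dot hy _).const_mul 2)
  simp only [h1]
  refine ⟨h2.add (integrable_qf hy G), ?_⟩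
  rw [integral_add h2 (integrable_qf hy G), integral_add (integrable_const _)
    ((integrable_dot hy _).const_mul 2), integral_const_mul, integral_dot_eq_zero hy hy0]
  simp

end Moments

/-! ### The average cost of a linear feedback -/

section AverageCost

variable {n m : ℕ} {Ω : Type*} [MeasurableSpace Ω] {μ : Measure Ω}
  {x₀ : Ω → Fin n → ℝ} {w : ℕ → Ω → Fin n → ℝ} {σx σw : ℝ}
  {A : Matrix (Fin n) (Fin n) ℝ} {B : Matrix (Fin n) (Fin m) ℝ} {K : Matrix (Fin m) (Fin n) ℝ}

lemma closedLoop_mulVec (A : Matrix (Fin n) (Fin n) ℝ) (B : Matrix (Fin n) (Fin m) ℝ)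
    (K : Matrix (Fin m) (Fin n) ℝ) (x : Fin n → ℝ) :
    A *ᵥ x + B *ᵥ (-(K *ᵥ x)) = (A - B * K) *ᵥ x := by
  rw [Matrix.sub_mulVec, Matrix.mulVec_neg, Matrix.mulVec_mulVec, sub_eq_add_neg]

lemma closedLoopState_succ {Ω : Type*} {x₀ : Ω → Fin n → ℝ} {w : ℕ → Ω → Fin n → ℝ} (t : ℕ) :
    closedLoopState A B K x₀ w (t + 1)
    = fun ω => (A - B * K) *ᵥ closedLoopState A B K x₀ w t ω + w t ω := by
  ext1 ω
  rw [closedLoopState, closedLoop_mulVec]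

lemma memLp_closedLoopState (hN : IsNoiseModel μ x₀ w σx σw) (t : ℕ) (i : Fin n) :
    MemLp (fun ω => closedLoopState A B K x₀ w t ω i) 2 μ := by
  induction t generalizing i with
  | zero => exact hN.memLp_init i
  | succ t ih =>
    rw [closedLoopState_succ]
    exact (memLp_mulVec ih _ i).add (hN.memLp_noise t i)

/-- The state at time t is built from the initial state and the noise strictly before t, so s = t is
allowed. -/
lemma crossCov_closedLoopState_noise (hN : IsNoiseModel μ x₀ w σx σw) (t s : ℕ) (hts : t ≤ s) :
    crossCov μ (closedLoopState A B K x₀ w t) (w s) = 0 := by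
  induction t with
  | zero => ext i j; exact hN.uncorrelated_init s i j
  | succ t ih =>
    have h0 : crossCov μ (w t) (w s) = 0 := by
      ext i j; exact hN.uncorrelated_noise t s (by omega) i j
    rw [closedLoopState_succ, crossCov_add_left (memLp_mulVec (memLp_closedLoopState hN t) _)
      (hN.memLp_noise t) (hN.memLp_noise s), crossCov_mulVec_left (memLp_closedLoopState hN t)
      (hN.memLp_noise s), ih (by omega), h0, mul_zero, add_zero]

lemma crossCov_closedLoopState_succ (hN : IsNoiseModel μ x₀ w σx σw) (t : ℕ) :
    crossCov μ (closedLoopState A B K x₀ w (t + 1)) (closedLoopState A B K x₀ w (t + 1))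
      = (A - B * K) * crossCov μ (closedLoopState A B K x₀ w t) (closedLoopState A B K x₀ w t)
          * (A - B * K)ᵀ + σw ^ 2 • 1 := by
  have hx := memLp_closedLoopState (A := A) (B := B) (K := K) hN t
  have hw := hN.memLp_noise t
  have hLx := memLp_mulVec hx (A - B * K)
  have h0 := crossCov_closedLoopState_noise (A := A) (B := B) (K := K) hN t t le_rfl
  have h1 : crossCov μ (w t) (closedLoopState A B K x₀ w t) = 0 := by
    rw [← crossCov_transpose, h0, Matrix.transpose_zero]
  have h2 : crossCov μ (w t) (w t) = σw ^ 2 • 1 := by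
    ext i j
    rw [crossCov_apply, hN.cov_noise]
    simp [Matrix.one_apply]
  have hLw : ∀ i, MemLp (fun ω => ((A - B * K) *ᵥ closedLoopState A B K x₀ w t ω + w t ω) i) 2 μ :=
    fun i => (hLx i).add (hw i)
  rw [closedLoopState_succ, crossCov_add_left hLx hw hLw, crossCov_add_right hLx hLx hw,
    crossCov_add_right hw hLx hw, crossCov_mulVec_left hx hLx, crossCov_mulVec_right hx hx,
    crossCov_mulVec_left hx hw, crossCov_mulVec_right hw hx, h0, h1, h2, mul_zero, zero_mul,
    zero_add, add_zero, Matrix.mul_assoc]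

lemma crossCov_closedLoopState (hN : IsNoiseModel μ x₀ w σx σw) (t : ℕ) :
    crossCov μ (closedLoopState A B K x₀ w t) (closedLoopState A B K x₀ w t)
      = σx ^ 2 • ((A - B * K) ^ t * ((A - B * K) ^ t)ᵀ)
        + σw ^ 2 • ∑ k ∈ Finset.range t, (A - B * K) ^ k * ((A - B * K) ^ k)ᵀ := by
  induction t with
  | zero =>
    ext i j
    rw [crossCov_apply]
    refine (hN.cov_init i j).trans ?_
    simp [Matrix.one_apply]
  | succ t ih =>
    rw [crossCov_closedLoopState_succ hN, ih]
    generalize A - B * K = M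
    rw [Finset.sum_range_succ']
    simp only [pow_succ', pow_zero, Matrix.transpose_mul, mul_add, add_mul, Finset.mul_sum,
      Finset.sum_mul, smul_add, Matrix.mul_smul, Matrix.smul_mul, Matrix.mul_assoc, mul_one,
      Matrix.transpose_one, add_assoc]

lemma norm_mul_transpose_le {k : ℕ} (M : Matrix (Fin k) (Fin k) ℝ) : ‖M * Mᵀ‖ ≤ ‖M‖ ^ 2 := by
  refine (Matrix.l2_opNorm_mul _ _).trans ?_
  rw [← Matrix.conjTranspose_eq_transpose_of_trivial, Matrix.l2_opNorm_conjTranspose, sq]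

/-- Convergence of the state covariance of a stable closed loop. -/
lemma exists_tendsto_crossCov (hN : IsNoiseModel μ x₀ w σx σw) {C θ : ℝ}
    (hθ : 0 ≤ θ) (hθ1 : θ < 1) (hM : ∀ k, ‖(A - B * K) ^ k‖ ^ 2 ≤ C * θ ^ k) :
    ∃ X : Matrix (Fin n) (Fin n) ℝ,
      Tendsto (fun t => crossCov μ (closedLoopState A B K x₀ w t) (closedLoopState A B K x₀ w t))
        atTop (𝓝 X) ∧ ‖X‖ ≤ σw ^ 2 * (C * (1 - θ)⁻¹) := by
  have h1 : ∀ k, ‖(A - B * K) ^ k * ((A - B * K) ^ k)ᵀ‖ ≤ C * θ ^ k :=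
    fun k => (norm_mul_transpose_le _).trans (hM k)
  have hg := (hasSum_geometric_of_lt_one hθ hθ1).mul_left C
  have hs := Summable.of_norm_bounded hg.summable h1
  refine ⟨σw ^ 2 • ∑' k, (A - B * K) ^ k * ((A - B * K) ^ k)ᵀ, ?_, ?_⟩
  · simp only [crossCov_closedLoopState hN]
    have h2 : Tendsto (fun t => (A - B * K) ^ t * ((A - B * K) ^ t)ᵀ) atTop (𝓝 0) :=
      squeeze_zero_norm h1 (by
        simpa using (tendsto_pow_atTop_nhds_zero_of_lt_one hθ hθ1).const_mul C)
    simpa using (h2.const_smul (σx ^ 2)).add (hs.hasSum.tendsto_sum_nat.const_smul (σw ^ 2))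
  · rw [norm_smul, Real.norm_of_nonneg (sq_nonneg _)]
    gcongr
    exact tsum_of_norm_bounded hg h1

lemma trace_conj_mul (D : Matrix (Fin m) (Fin n) ℝ) (T : Matrix (Fin m) (Fin m) ℝ)
    (X : Matrix (Fin n) (Fin n) ℝ) : (Dᵀ * T * D * X).trace = (T * (D * X * Dᵀ)).trace := by
  rw [Matrix.mul_assoc, Matrix.mul_assoc, Matrix.trace_mul_comm, Matrix.mul_assoc]

/-- The average cost in terms of a stationary value function `P` and the excess `G` of the
feedback in the Bellman equation. -/
lemma hasAverageCost_of_bellman (hN : IsNoiseModel μ x₀ w σx σw)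
    {Q P G : Matrix (Fin n) (Fin n) ℝ} {R : Matrix (Fin m) (Fin m) ℝ}
    (hcost : ∀ x, qf Q x + qf R (-(K *ᵥ x)) + qf P ((A - B * K) *ᵥ x) = qf P x + qf G x)
    {X : Matrix (Fin n) (Fin n) ℝ}
    (hX : Tendsto (fun t => crossCov μ (closedLoopState A B K x₀ w t)
      (closedLoopState A B K x₀ w t)) atTop (𝓝 X)) :
    HasAverageCost μ A B Q R x₀ w K ((G * X).trace + σw ^ 2 * P.trace) := by
  set x := closedLoopState A B K x₀ w
  have hx := fun t => memLp_closedLoopState (A := A) (B := B) (K := K) hN t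
  have hcost' : ∀ t ω, stageCost Q R (x t ω) (-(K *ᵥ x t ω))
      = qf P (x t ω) + qf G (x t ω) - qf ((A - B * K)ᵀ * P * (A - B * K)) (x t ω) := fun t ω => by
    rw [qf_conj, ← hcost]
    simp only [stageCost, qf, bf]
    ring
  have hint : ∀ t, Integrable (fun ω => stageCost Q R (x t ω) (-(K *ᵥ x t ω))) μ := fun t => by
    simp only [hcost']
    exact ((integrable_qf (hx t) P).add (integrable_qf (hx t) G)).sub (integrable_qf (hx t) _)
  -- The expected next value contains σw²·tr P from the noise. The two remaining `P` terms have the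
  -- same limit and cancel, leaving the `G` term.
  have hval : ∀ t, ∫ ω, stageCost Q R (x t ω) (-(K *ᵥ x t ω)) ∂μ
      = (P * crossCov μ (x t) (x t)).trace + (G * crossCov μ (x t) (x t)).trace
        - (P * crossCov μ (x (t + 1)) (x (t + 1))).trace + σw ^ 2 * P.trace := fun t => by
    simp only [hcost']
    have hPG : Integrable (fun ω => qf P (x t ω) + qf G (x t ω)) μ :=
      (integrable_qf (hx t) P).add (integrable_qf (hx t) G)
    rw [integral_sub hPG (integrable_qf (hx t) _), integral_add (integrable_qf (hx t) P)
      (integrable_qf (hx t) G), integral_qf (hx t), integral_qf (hx t), integral_qf (hx t),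
      crossCov_closedLoopState_succ hN, mul_add, Matrix.trace_add, Matrix.mul_smul,
      Matrix.trace_smul, mul_one, smul_eq_mul, trace_conj_mul]
    ring
  have htr : ∀ M : Matrix (Fin n) (Fin n) ℝ,
      Tendsto (fun t => (M * crossCov μ (x t) (x t)).trace) atTop (𝓝 (M * X).trace) := fun M =>
    ((continuous_const.mul continuous_id).matrix_trace.tendsto X).comp hX
  have hlim : Tendsto (fun t => ∫ ω, stageCost Q R (x t ω) (-(K *ᵥ x t ω)) ∂μ) atTop
      (𝓝 ((G * X).trace + σw ^ 2 * P.trace)) := by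
    simp only [hval]
    have h := (((htr P).add (htr G)).sub ((htr P).comp (tendsto_add_atTop_nat 1))).add_const
      (σw ^ 2 * P.trace)
    rwa [add_sub_cancel_left] at h
  have havg : avgCost μ A B Q R x₀ w K
      = fun T : ℕ => (T : ℝ)⁻¹ * ∑ t ∈ Finset.range T,
        ∫ ω, stageCost Q R (x t ω) (-(K *ᵥ x t ω)) ∂μ := by
    ext1 T
    rw [avgCost, integral_finsetSum _ fun t _ => hint t, one_div]
  rw [HasAverageCost, havg]
  exact hlim.cesaro

lemma abs_trace_le {k : ℕ} (M : Matrix (Fin k) (Fin k) ℝ) : |M.trace| ≤ k * ‖M‖ := by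
  have h : ∀ i, |M i i| ≤ ‖M‖ := fun i => by
    have := abs_qf_le_norm M (Pi.single i 1)
    simpa [qf, bf] using this
  calc |M.trace| ≤ ∑ i, |M i i| := Finset.abs_sum_le_sum_abs _ _
    _ ≤ ∑ _i : Fin k, ‖M‖ := Finset.sum_le_sum fun i _ => h i
    _ = k * ‖M‖ := by simp

/-- Cyclicity moves the trace to an m × m matrix, hence the factor m instead of n. -/
lemma trace_conj_mul_le (D : Matrix (Fin m) (Fin n) ℝ) (T : Matrix (Fin m) (Fin m) ℝ)
    (X : Matrix (Fin n) (Fin n) ℝ) : (Dᵀ * T * D * X).trace ≤ m * (‖T‖ * ‖D‖ ^ 2 * ‖X‖) := by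
  rw [trace_conj_mul]
  refine (le_abs_self _).trans ((abs_trace_le _).trans ?_)
  gcongr
  have h2 : ‖Dᵀ‖ = ‖D‖ := by
    rw [← Matrix.conjTranspose_eq_transpose_of_trivial, Matrix.l2_opNorm_conjTranspose]
  calc ‖T * (D * X * Dᵀ)‖ ≤ ‖T‖ * (‖D‖ * ‖X‖ * ‖Dᵀ‖) := by
        refine (Matrix.l2_opNorm_mul _ _).trans ?_
        gcongr
        refine (Matrix.l2_opNorm_mul _ _).trans ?_
        gcongr
        exact Matrix.l2_opNorm_mul _ _
    _ = _ := by rw [h2]; ring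

end AverageCost

/-! ### The receding-horizon problem -/

section RecedingHorizon

variable {n m : ℕ} {Ω : Type*} [MeasurableSpace Ω] {μ : Measure Ω}
  {x₀ : Ω → Fin n → ℝ} {w : ℕ → Ω → Fin n → ℝ} {σx σw : ℝ}
  (A : Matrix (Fin n) (Fin n) ℝ) (B : Matrix (Fin n) (Fin m) ℝ)
  (Q : Matrix (Fin n) (Fin n) ℝ) {R : Matrix (Fin m) (Fin m) ℝ} {P : Matrix (Fin n) (Fin n) ℝ}

/-- The noise-free predicted state. -/
def nominalState (A : Matrix (Fin n) (Fin n) ℝ) (B : Matrix (Fin n) (Fin m) ℝ) (x : Fin n → ℝ)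
    (u : ℕ → Fin m → ℝ) : ℕ → Fin n → ℝ
  | 0 => x
  | k + 1 => A *ᵥ nominalState A B x u k + B *ᵥ u k

/-- The contribution of the noise to the predicted state. -/
def noiseState (A : Matrix (Fin n) (Fin n) ℝ) (w : ℕ → Ω → Fin n → ℝ) (t : ℕ) :
    ℕ → Ω → Fin n → ℝ
  | 0, _ => 0
  | k + 1, ω => A *ᵥ noiseState A w t k ω + w (k + t) ω

/-- The noise-free cost over the horizon. -/
def nominalCost (A : Matrix (Fin n) (Fin n) ℝ) (B : Matrix (Fin n) (Fin m) ℝ)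
    (Q : Matrix (Fin n) (Fin n) ℝ) (R : Matrix (Fin m) (Fin m) ℝ) (P : Matrix (Fin n) (Fin n) ℝ)
    (N : ℕ) (x : Fin n → ℝ) (u : ℕ → Fin m → ℝ) : ℝ :=
  (∑ k ∈ Finset.range N, (qf Q (nominalState A B x u k) + qf R (u k)))
    + qf P (nominalState A B x u N)

/-- Superposition: the noise part does not depend on the inputs and has mean zero, so it adds only a
constant to the expected cost. -/
lemma predState_eq {Ω : Type*} {w : ℕ → Ω → Fin n → ℝ} (t : ℕ) (x : Fin n → ℝ) (u : ℕ → Fin m → ℝ) (k : ℕ) (ω : Ω) :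
    predState A B w t x u k ω = nominalState A B x u k + noiseState A w t k ω := by
  induction k with
  | zero => simp [predState, nominalState, noiseState]
  | succ k ih => rw [predState, ih, nominalState, noiseState, Matrix.mulVec_add]; abel

lemma memLp_noiseState (hN : IsNoiseModel μ x₀ w σx σw) (t k : ℕ) (i : Fin n) :
    MemLp (fun ω => noiseState A w t k ω i) 2 μ := by
  induction k generalizing i with
  | zero => exact MemLp.zero
  | succ k ih => exact (memLp_mulVec ih A i).add (hN.memLp_noise (k + t) i)

lemma integral_noiseState [IsProbabilityMeasure μ] (hN : IsNoiseModel μ x₀ w σx σw) (t k : ℕ)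
    (i : Fin n) : ∫ ω, noiseState A w t k ω i ∂μ = 0 := by
  induction k generalizing i with
  | zero => simp [noiseState]
  | succ k ih =>
    have h1 := memLp_noiseState A hN t k
    simp only [noiseState, Pi.add_apply]
    rw [integral_add ((memLp_mulVec h1 A i).integrable one_le_two)
      ((hN.memLp_noise _ i).integrable one_le_two), hN.mean_noise, add_zero]
    exact integral_dot_eq_zero h1 ih (A i)

/-- The expected cost differs from the noise-free one by a constant. -/
lemma horizonCost_eq [IsProbabilityMeasure μ] (hN : IsNoiseModel μ x₀ w σx σw) (hQ : Qᵀ = Q)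
    (hP : Pᵀ = P) (N t : ℕ) (x : Fin n → ℝ) (u : ℕ → Fin m → ℝ) :
    horizonCost μ A B Q R P N w t x u = nominalCost A B Q R P N x u
      + ((∑ k ∈ Finset.range N, ∫ ω, qf Q (noiseState A w t k ω) ∂μ)
        + ∫ ω, qf P (noiseState A w t N ω) ∂μ) := by
  have hQk := fun k => integral_qf_const_add (memLp_noiseState A hN t k)
    (integral_noiseState A hN t k) hQ (nominalState A B x u k)
  have hPN := integral_qf_const_add (memLp_noiseState A hN t N)
    (integral_noiseState A hN t N) hP (nominalState A B x u N)
  have h1 : ∀ ω, (∑ k ∈ Finset.range N, stageCost Q R (predState A B w t x u k ω) (u k))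
      + predState A B w t x u N ω ⬝ᵥ P *ᵥ predState A B w t x u N ω
      = (∑ k ∈ Finset.range N, (qf Q (nominalState A B x u k + noiseState A w t k ω)
          + qf R (u k))) + qf P (nominalState A B x u N + noiseState A w t N ω) := fun ω => by
    simp only [predState_eq]
    rfl
  have h2 : ∀ k ∈ Finset.range N, Integrable (fun ω =>
      qf Q (nominalState A B x u k + noiseState A w t k ω) + qf R (u k)) μ :=
    fun k _ => (hQk k).1.add (integrable_const _)
  simp only [horizonCost, h1]
  rw [integral_add (integrable_finsetSum _ h2) hPN.1, integral_finsetSum _ h2, hPN.2]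
  have h3 : ∀ k, ∫ ω, (qf Q (nominalState A B x u k + noiseState A w t k ω) + qf R (u k)) ∂μ
      = (qf Q (nominalState A B x u k) + qf R (u k)) + ∫ ω, qf Q (noiseState A w t k ω) ∂μ :=
    fun k => by
      rw [integral_add (hQk k).1 (integrable_const _), (hQk k).2]
      simp
      ring
  simp only [h3, Finset.sum_add_distrib, nominalCost]
  ring

lemma nominalState_shift (x : Fin n → ℝ) (u : ℕ → Fin m → ℝ) (k : ℕ) :
    nominalState A B x u (k + 1)
      = nominalState A B (A *ᵥ x + B *ᵥ u 0) (fun j => u (j + 1)) k := by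
  induction k with
  | zero => rfl
  | succ k ih => rw [nominalState, ih]; rfl

lemma nominalCost_succ (N : ℕ) (x : Fin n → ℝ) (u : ℕ → Fin m → ℝ) :
    nominalCost A B Q R P (N + 1) x u = qf Q x + qf R (u 0)
      + nominalCost A B Q R P N (A *ᵥ x + B *ᵥ u 0) (fun j => u (j + 1)) := by
  simp only [nominalCost, Finset.sum_range_succ', nominalState_shift]
  simp only [nominalState]
  ring

lemma le_nominalCost (hR : R.PosDef) (hQ : Q.PosSemidef) (hP : P.PosSemidef) (N : ℕ)
    (x : Fin n → ℝ) (u : ℕ → Fin m → ℝ) :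
    qf ((riccati A B Q R)^[N] P) x ≤ nominalCost A B Q R P N x u := by
  induction N generalizing x u with
  | zero => simp [nominalCost, nominalState]
  | succ N ih =>
    rw [Function.iterate_succ_apply', nominalCost_succ]
    refine (riccati_le A B Q hR (riccati_iterate_posSemidef A B Q hR hQ hP N) x (u 0)).trans ?_
    gcongr
    exact ih _ _

/-- Dynamic programming that keeps the completed square of the first step, which pins down the first
input of every minimizer. -/
lemma le_nominalCost_succ (hR : R.PosDef) (hQ : Q.PosSemidef) (hP : P.PosSemidef) (N : ℕ)
    (x : Fin n → ℝ) (u : ℕ → Fin m → ℝ) :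
    qf ((riccati A B Q R)^[N + 1] P) x + qf (gramR B R ((riccati A B Q R)^[N] P))
      (u 0 + mpcGain A B Q R P (N + 1) *ᵥ x) ≤ nominalCost A B Q R P (N + 1) x u := by
  rw [Function.iterate_succ_apply', nominalCost_succ, mpcGain, Nat.add_sub_cancel,
    ← bellman_eq A B Q hR (riccati_iterate_posSemidef A B Q hR hQ hP N)]
  gcongr
  exact le_nominalCost A B Q hR hQ hP N _ _

lemma exists_nominalCost_eq (hR : R.PosDef) (hQ : Q.PosSemidef) (hP : P.PosSemidef) (N : ℕ)
    (x : Fin n → ℝ) :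
    ∃ u, nominalCost A B Q R P N x u = qf ((riccati A B Q R)^[N] P) x
      ∧ u 0 = -(mpcGain A B Q R P N *ᵥ x) := by
  induction N generalizing x with
  -- With horizon zero no input enters the cost, so `u 0` is free to be the value demanded.
  | zero => exact ⟨fun _ => _, by simp [nominalCost, nominalState], rfl⟩
  | succ N ih =>
    obtain ⟨u, hu, -⟩ := ih (A *ᵥ x + B *ᵥ (-(mpcGain A B Q R P (N + 1) *ᵥ x)))
    refine ⟨fun k => Nat.casesOn k (-(mpcGain A B Q R P (N + 1) *ᵥ x)) u, ?_, rfl⟩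
    rw [nominalCost_succ, Function.iterate_succ_apply']
    refine Eq.trans ?_
      (riccati_attained A B Q hR (riccati_iterate_posSemidef A B Q hR hQ hP N) x).symm
    congr 1

/-- The receding-horizon controller is the linear feedback with gain `mpcGain`. -/
theorem isRecedingHorizonLaw_iff [IsProbabilityMeasure μ] (hNoise : IsNoiseModel μ x₀ w σx σw)
    (hR : R.PosDef) (hQ : Q.PosSemidef) (hP : P.PosSemidef) {N : ℕ} (hN : 1 ≤ N) (t : ℕ)
    (κ : (Fin n → ℝ) → Fin m → ℝ) :
    IsRecedingHorizonLaw μ A B Q R P N w t κ ↔ ∀ x, κ x = -(mpcGain A B Q R P N *ᵥ x) := by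
  obtain ⟨N, rfl⟩ : ∃ N', N = N' + 1 := ⟨N - 1, by omega⟩
  refine forall_congr' fun x => ?_
  simp only [horizonCost_eq A B Q hNoise (transpose_of_posSemidef hQ) (transpose_of_posSemidef hP),
    add_le_add_iff_right]
  obtain ⟨v, hv, hv0⟩ := exists_nominalCost_eq A B Q hR hQ hP (N + 1) x
  constructor
  · rintro ⟨u, hu, hκ⟩
    have h1 := (le_nominalCost_succ A B Q hR hQ hP N x u).trans (hu v)
    rw [hv] at h1
    have h2 := gramR_posDef B hR (riccati_iterate_posSemidef A B Q hR hQ hP N)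
    rw [hκ]
    by_contra hne
    have h3 := h2.dotProduct_mulVec_pos
      (x := u 0 + mpcGain A B Q R P (N + 1) *ᵥ x) (fun h => hne (eq_neg_of_add_eq_zero_left h))
    rw [star_trivial] at h3
    change 0 < qf _ _ at h3
    linarith
  · intro hκ
    refine ⟨v, fun u => ?_, hκ.trans hv0.symm⟩
    rw [hv]
    exact le_nominalCost A B Q hR hQ hP (N + 1) x u

end RecedingHorizon

/-! ### Suboptimality of a perturbed gain -/

namespace IsRiccatiSolution

variable {n m : ℕ} {A A' : Matrix (Fin n) (Fin n) ℝ} {B B' : Matrix (Fin n) (Fin m) ℝ}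
  {Q : Matrix (Fin n) (Fin n) ℝ} {R : Matrix (Fin m) (Fin m) ℝ} {P : Matrix (Fin n) (Fin n) ℝ}
  {K : Matrix (Fin m) (Fin n) ℝ}

/-- The Bellman equation for an arbitrary gain. -/
lemma bellman_gain (S : IsRiccatiSolution A B Q R P) (K : Matrix (Fin m) (Fin n) ℝ)
    (x : Fin n → ℝ) :
    qf Q x + qf R (-(K *ᵥ x)) + qf P ((A - B * K) *ᵥ x)
      = qf P x + qf ((gain A B R P - K)ᵀ * gramR B R P * (gain A B R P - K)) x := by
  rw [← closedLoop_mulVec, bellman_eq A B Q S.R_posDef S.hP, ← S.eq, qf_conj, Matrix.sub_mulVec,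
    neg_add_eq_sub]

/-- The excess in the Bellman equation is at most one percent of xᵀx ≤ xᵀQx, so 99 percent of the
state cost remains as decrease of P. -/
lemma qf_perturbed_closedLoop_le (S : IsRiccatiSolution A B Q R P)
    (hK : ∀ x, qf ((gain A B R P - K)ᵀ * gramR B R P * (gain A B R P - K)) x
      ≤ 1 / 100 * (x ⬝ᵥ x)) (x : Fin n → ℝ) :
    qf P ((A - B * K) *ᵥ x) ≤ (1 - 99 / 100 * (betaStar Q P)⁻¹) * qf P x := by
  have h1 := S.bellman_gain K x
  have h2 := hK x
  have h3 := dot_self_le_qf S.hQ x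
  have h4 := S.inv_betaStar_mul_le x
  have h5 := LQ.qf_nonneg (-(K *ᵥ x)) S.R_posDef.posSemidef
  linarith

lemma norm_gain_sub_le (S : IsRiccatiSolution A B Q R P) {d : ℝ} (hd : 0 ≤ d)
    (hK : ∀ x, qf ((gain A B R P - K)ᵀ * gramR B R P * (gain A B R P - K)) x
      ≤ d ^ 2 * (x ⬝ᵥ x)) : ‖gain A B R P - K‖ ≤ d := by
  refine norm_le_of_dot_mulVec_le hd fun x => (le_trans ?_ (hK x))
  rw [qf_conj, qf_gramR]
  linarith [dot_self_le_qf S.hR ((gain A B R P - K) *ᵥ x),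
    S.qf_nonneg (B *ᵥ ((gain A B R P - K) *ᵥ x))]

/-- Stability and suboptimality of a gain close to the optimal one. -/
theorem suboptimality (S : IsRiccatiSolution A B Q R P) {Ω : Type*} [MeasurableSpace Ω]
    {μ : Measure Ω} {x₀ : Ω → Fin n → ℝ} {w : ℕ → Ω → Fin n → ℝ} {σx σw : ℝ}
    (hN : IsNoiseModel μ x₀ w σx σw) {d : ℝ} (hd : 0 ≤ d) (hd' : d ^ 2 ≤ 1 / 100)
    (hK : ∀ x, qf ((gain A B R P - K)ᵀ * gramR B R P * (gain A B R P - K)) x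
      ≤ d ^ 2 * (x ⬝ᵥ x)) :
    IsSchurStable (A - B * K) ∧ ∃ J Jstar : ℝ,
      HasAverageCost μ A B Q R x₀ w K J ∧
      HasAverageCost μ A B Q R x₀ w (gain A B R P) Jstar ∧
      J - Jstar ≤ m * (‖gramR B R P‖ * d ^ 2 * (σw ^ 2 * (2 * betaStar Q P ^ 2))) := by
  have hβ := S.one_le_betaStar
  have hβ0 : 0 < (betaStar Q P)⁻¹ := by positivity
  have hβ1 : (betaStar Q P)⁻¹ ≤ 1 := inv_le_one_of_one_le₀ hβ
  have hPd : P.PosDef := Matrix.PosDef.of_dotProduct_mulVec_pos S.hP.1 fun x hx => by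
    have h1 : x ⬝ᵥ x ≠ 0 := fun h => hx (dotProduct_self_eq_zero.1 h)
    have h2 := S.dot_le x
    have h3 := (dot_self_nonneg x).lt_of_ne' h1
    rw [star_trivial]
    exact h3.trans_le h2
  have hcov : ∀ (K : Matrix (Fin m) (Fin n) ℝ) (θ : ℝ), 0 ≤ θ → θ < 1 →
      (∀ x, qf P ((A - B * K) *ᵥ x) ≤ θ * qf P x) → _ := fun K θ h0 h1 h =>
    exists_tendsto_crossCov (A := A) (B := B) (K := K) hN h0 h1
      (norm_pow_sq_le (by linarith [S.one_le_minSingularValue]) S.minSingularValue_mul_le h0 h)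
  have hloop := S.qf_perturbed_closedLoop_le (K := K) fun x =>
    (hK x).trans (mul_le_mul_of_nonneg_right hd' (dot_self_nonneg x))
  obtain ⟨X, hX, hXn⟩ := hcov K _ (by linarith) (by linarith) hloop
  obtain ⟨Xs, hXs, -⟩ := hcov (gain A B R P) (1 - (betaStar Q P)⁻¹) (by linarith) (by linarith)
    fun x => by rw [← closedLoop_mulVec]; exact S.qf_closedLoop_le x
  refine ⟨isSchurStable_of_contraction hPd (by linarith) hloop, _, _,
    hasAverageCost_of_bellman hN (S.bellman_gain K) hX,
    hasAverageCost_of_bellman hN (S.bellman_gain _) hXs, ?_⟩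
  -- The optimal gain has no excess, so its average cost is σw²·tr P, the common part of both costs.
  have h0 : ((gain A B R P - gain A B R P)ᵀ * gramR B R P * (gain A B R P - gain A B R P)
      * Xs).trace = 0 := by simp
  rw [h0, zero_add, add_sub_cancel_right]
  refine (trace_conj_mul_le _ _ _).trans ?_
  gcongr
  · exact S.norm_gain_sub_le hd hK
  · refine hXn.trans ?_
    rw [← betaStar]
    refine mul_le_mul_of_nonneg_left ?_ (sq_nonneg σw)
    -- The geometric sum contributes (100/99)β and the condition number ‖P‖/σ_min(Q) another β; the
    -- product is at most 2β².
    have : (1 - (1 - 99 / 100 * (betaStar Q P)⁻¹))⁻¹ = 100 / 99 * betaStar Q P := by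
      rw [sub_sub_cancel, mul_inv, inv_inv]
      norm_num
    rw [this]
    nlinarith

end IsRiccatiSolution

lemma norm_gramR_le {n m : ℕ} {B : Matrix (Fin n) (Fin m) ℝ} {R : Matrix (Fin m) (Fin m) ℝ}
    {P : Matrix (Fin n) (Fin n) ℝ} {Υ : ℝ} (hΥ : 0 ≤ Υ) (hB : ‖B‖ ≤ Υ) (hP : ‖P‖ ≤ Υ) :
    ‖gramR B R P‖ ≤ ‖R‖ + Υ ^ 3 := by
  refine (norm_add_le _ _).trans ?_
  gcongr
  have h2 : ‖Bᵀ‖ = ‖B‖ := by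
    rw [← Matrix.conjTranspose_eq_transpose_of_trivial, Matrix.l2_opNorm_conjTranspose]
  calc ‖Bᵀ * P * B‖ ≤ ‖Bᵀ‖ * ‖P‖ * ‖B‖ := by
        refine (Matrix.l2_opNorm_mul _ _).trans ?_
        gcongr
        exact Matrix.l2_opNorm_mul _ _
    _ ≤ Υ * Υ * Υ := by rw [h2]; gcongr
    _ = _ := by ring

/-- Convergence of the Riccati iteration of the perturbed model, in the order generated by the
solution of the algebraic Riccati equation of the true model. -/
theorem IsRiccatiSolution.exists_riccati_iterate_le {n m : ℕ} {A A' : Matrix (Fin n) (Fin n) ℝ}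
    {B B' : Matrix (Fin n) (Fin m) ℝ} {Q : Matrix (Fin n) (Fin n) ℝ}
    {R : Matrix (Fin m) (Fin m) ℝ} {P P₀ : Matrix (Fin n) (Fin n) ℝ}
    (S : IsRiccatiSolution A B Q R P) (hP₀ : P₀.PosSemidef) {ε e Υ : ℝ} (hε : 0 ≤ ε) (he : 0 ≤ e)
    (hA : ‖A' - A‖ ≤ ε) (hB : ‖B' - B‖ ≤ ε) (hPe : ‖P₀ - P‖ ≤ e) (hPΥ : ‖P‖ ≤ Υ) {i : ℕ}
    (hsmall : ε + errorBound Υ ‖P‖ (betaStar Q P) ε e i ≤ 1 / (40 * Υ ^ 4 * ‖P‖ ^ 2)) :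
    ∃ c, 0 ≤ c ∧ ‖P‖ * c ≤ errorBound Υ ‖P‖ (betaStar Q P) ε e i ∧
      ∀ x, |qf ((riccati A' B' Q R)^[i] P₀) x - qf P x| ≤ c * qf P x := by
  have hβ := S.one_le_betaStar
  have hβp := S.betaStar_le_norm
  have hp := S.one_le_norm
  have hΥ : 0 ≤ Υ := by linarith
  have hσ := S.one_le_minSingularValue
  have hσp := S.minSingularValue_le_norm
  have hσ0 : 0 < minSingularValue Q := by linarith
  obtain ⟨-, hs2, hs3⟩ := modelError_le hβ hβp hPΥ hε he hsmall
  have hg := gamma_mul_lt_one hβ hβp hPΥ hε he hsmall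
  have hg0 := gamma_mul_nonneg (p := ‖P‖) hΥ (by linarith : 0 ≤ betaStar Q P) hε he
  have hE := errorBound_ge (by linarith) hΥ hε he hs2 hg i
  have hcontr := contraction_sq_le hβ hβp hPΥ hε he hs2
  set g := gamma₁ Υ (betaStar Q P) ε e * gamma₂ ‖P‖ (betaStar Q P) ε
  have hψ := psiTilde_nonneg hΥ hε
  have hsum : 0 ≤ ∑ j ∈ Finset.range i, g ^ j := Finset.sum_nonneg fun j _ => by positivity
  -- As P ⪰ σ_min(Q)·I, an absolute error becomes relative on division by σ_min(Q); multiplying by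
  -- ‖P‖ restores the factor β of `errorBound`.
  refine ⟨g ^ i * (e / minSingularValue Q)
    + psiTilde Υ ε / minSingularValue Q * ∑ j ∈ Finset.range i, g ^ j, by positivity, ?_, ?_⟩
  · refine le_trans (le_of_eq ?_) hE
    rw [betaStar]
    field_simp
  · refine S.abs_riccati_iterate_sub_le (A' := A') (B' := B') (by positivity) (by positivity) ?_
      (fun x => ?_) (fun x => ?_) hP₀ (fun x => ?_) i
    · refine le_trans ?_ hcontr
      have h1 := Real.sq_sqrt S.one_sub_inv_betaStar_nonneg
      have h2 : 0 ≤ √(2 * ‖P‖) * ε := by positivity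
      nlinarith [Real.sqrt_nonneg (1 - (betaStar Q P)⁻¹)]
    · refine (S.abs_riccati_perturbed_sub_le hε hA hB x).trans
        (mul_le_mul_of_nonneg_right ?_ (S.qf_nonneg x))
      rw [le_div_iff₀ hσ0]
      refine le_trans ?_ (psiTilde_ge hp hPΥ hε hs3)
      gcongr
    · exact (S.closedLoop_perturbed_le hε hA hB x).trans
        (mul_le_mul_of_nonneg_right hcontr (S.qf_nonneg x))
    · rw [← qf_mat_sub, div_mul_eq_mul_div, le_div_iff₀ hσ0]
      calc _ ≤ e * (x ⬝ᵥ x) * minSingularValue Q := by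
            gcongr
            exact (abs_qf_le_norm _ x).trans (mul_le_mul_of_nonneg_right hPe (dot_self_nonneg x))
        _ = e * (minSingularValue Q * (x ⬝ᵥ x)) := by ring
        _ ≤ _ := mul_le_mul_of_nonneg_left (S.minSingularValue_mul_le x) he

end LQ

theorem proposition2 {n m : ℕ} (hn : 0 < n) (hmn : m ≤ n)
    {Ω : Type*} [MeasurableSpace Ω] (μ : Measure Ω) [IsProbabilityMeasure μ]
    (x₀ : Ω → Fin n → ℝ) (w : ℕ → Ω → Fin n → ℝ) (σx σw : ℝ)
    (hnoise : LQ.IsNoiseModel μ x₀ w σx σw)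
    (A Ahat : Matrix (Fin n) (Fin n) ℝ) (B Bhat : Matrix (Fin n) (Fin m) ℝ)
    (Q : Matrix (Fin n) (Fin n) ℝ) (R : Matrix (Fin m) (Fin m) ℝ)
    (hR : (R - 1).PosSemidef) (hQ : (Q - 1).PosSemidef)
    (hstab : LQ.IsStabilizable A B)
    (Pstar : Matrix (Fin n) (Fin n) ℝ) (hPstar : Pstar.PosDef)
    (hDARE : Pstar = LQ.riccati A B Q R Pstar)
    (P : Matrix (Fin n) (Fin n) ℝ) (hP : P.PosSemidef)
    (N : ℕ) (hN : 1 ≤ N)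
    (εm εp Υ : ℝ) (hεm : 0 ≤ εm) (hεp : 0 ≤ εp)
    (hAhat : ‖Ahat - A‖ ≤ εm) (hBhat : ‖Bhat - B‖ ≤ εm) (hPerr : ‖P - Pstar‖ ≤ εp)
    (hΥ : max 1 εm ≤ Υ) (hAΥ : ‖A‖ ≤ Υ) (hBΥ : ‖B‖ ≤ Υ) (hPΥ : ‖Pstar‖ ≤ Υ)
    (hsmall : εm + LQ.errorBound Υ ‖Pstar‖ (LQ.betaStar Q Pstar) εm εp (N - 1)
      ≤ 1 / (40 * Υ ^ 4 * ‖Pstar‖ ^ 2)) :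
    LQ.gamma₁ Υ (LQ.betaStar Q Pstar) εm εp * LQ.gamma₂ ‖Pstar‖ (LQ.betaStar Q Pstar) εm < 1 ∧
    (∀ (t : ℕ) (κ : (Fin n → ℝ) → Fin m → ℝ),
      LQ.IsRecedingHorizonLaw μ Ahat Bhat Q R P N w t κ ↔
        ∀ x, κ x = -(LQ.mpcGain Ahat Bhat Q R P N *ᵥ x)) ∧
    LQ.IsSchurStable (A - B * LQ.mpcGain Ahat Bhat Q R P N) ∧
    ∃ J Jstar : ℝ,
      LQ.HasAverageCost μ A B Q R x₀ w (LQ.mpcGain Ahat Bhat Q R P N) J ∧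
      LQ.HasAverageCost μ A B Q R x₀ w (LQ.gain A B R Pstar) Jstar ∧
      J - Jstar ≤ 128 * (m : ℝ) * σw ^ 2 * (‖R‖ + Υ ^ 3) * Υ ^ 4 * ‖Pstar‖ ^ 2 *
        (εm + LQ.errorBound Υ ‖Pstar‖ (LQ.betaStar Q Pstar) εm εp (N - 1)) ^ 2 := by
  have S : LQ.IsRiccatiSolution A B Q R Pstar := ⟨hn, hR, hQ, hPstar.posSemidef, hDARE⟩
  have hβ := S.one_le_betaStar
  have hβp := S.betaStar_le_norm
  have hp := S.one_le_norm
  have hΥ1 : 1 ≤ Υ := (le_max_left _ _).trans hΥ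
  obtain ⟨-, hs2, -⟩ := LQ.modelError_le hβ hβp hPΥ hεm hεp hsmall
  obtain ⟨c, hc0, hcE, hc⟩ :=
    S.exists_riccati_iterate_le hP hεm hεp hAhat hBhat hPerr hPΥ hsmall
  set E := LQ.errorBound Υ ‖Pstar‖ (LQ.betaStar Q Pstar) εm εp (N - 1)
  have hcE' : c ≤ E := (le_mul_of_one_le_left hc0 hp).trans hcE
  have hsmall' : 40 * Υ ^ 4 * ‖Pstar‖ ^ 2 * (εm + E) ≤ 1 := by
    rw [le_div_iff₀ (by positivity)] at hsmall
    linarith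
  have hEε : 0 ≤ εm + E := by linarith
  have hd : 3 * ‖Pstar‖ * (εm + E) ≤ 3 / 40 := by
    have h1 : ‖Pstar‖ * (εm + E) ≤ Υ ^ 4 * ‖Pstar‖ ^ 2 * (εm + E) := by
      gcongr
      calc ‖Pstar‖ = 1 * ‖Pstar‖ ^ 1 := by ring
        _ ≤ Υ ^ 4 * ‖Pstar‖ ^ 2 := by
          gcongr ?_ * ?_
          · exact one_le_pow₀ hΥ1
          · exact pow_le_pow_right₀ hp one_le_two
    linarith
  have hc40 : c ≤ 1 / 40 := by nlinarith
  -- One factor ‖P⋆‖ comes from `qf_gain_sub_le`, the other from xᵀP⋆x ≤ ‖P⋆‖·xᵀx.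
  have hK : ∀ x, LQ.qf ((LQ.gain A B R Pstar - LQ.mpcGain Ahat Bhat Q R P N)ᵀ
      * LQ.gramR B R Pstar * (LQ.gain A B R Pstar - LQ.mpcGain Ahat Bhat Q R P N)) x
      ≤ (3 * ‖Pstar‖ * (εm + E)) ^ 2 * (x ⬝ᵥ x) := fun x => by
    rw [LQ.qf_conj, Matrix.sub_mulVec, sub_eq_neg_add]
    calc _ ≤ 9 * ‖Pstar‖ * (εm + c) ^ 2 * LQ.qf Pstar x :=
          S.qf_gain_sub_le hεm hAhat hBhat hs2 hc0 hc40
            (LQ.riccati_iterate_posSemidef _ _ _ S.R_posDef S.Q_posSemidef hP _) hc x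
      _ ≤ 9 * ‖Pstar‖ * (εm + E) ^ 2 * (‖Pstar‖ * (x ⬝ᵥ x)) := by
          gcongr
          · exact S.qf_nonneg x
          · exact LQ.IsRiccatiSolution.qf_le x
      _ = _ := by ring
  obtain ⟨hstable, J, Jstar, hJ, hJstar, hJJ⟩ :=
    S.suboptimality hnoise (by positivity) (by nlinarith [mul_nonneg (norm_nonneg Pstar) hEε]) hK
  refine ⟨LQ.gamma_mul_lt_one hβ hβp hPΥ hεm hεp hsmall,
    LQ.isRecedingHorizonLaw_iff Ahat Bhat Q hnoise S.R_posDef S.Q_posSemidef hP hN,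
    hstable, J, Jstar, hJ, hJstar, hJJ.trans ?_⟩
  have hT := LQ.norm_gramR_le (R := R) (zero_le_one.trans hΥ1) hBΥ hPΥ
  have h1 : LQ.betaStar Q Pstar ^ 2 ≤ Υ ^ 4 := by
    calc LQ.betaStar Q Pstar ^ 2 ≤ Υ ^ 2 := by
          gcongr
          exact hβp.trans hPΥ
      _ ≤ Υ ^ 4 := pow_le_pow_right₀ hΥ1 (by norm_num)
  calc _ ≤ (m : ℝ) * ((‖R‖ + Υ ^ 3) * (3 * ‖Pstar‖ * (εm + E)) ^ 2 * (σw ^ 2 * (2 * Υ ^ 4))) := by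
        gcongr
    -- 18 = 3²·2, from the gain error and the covariance bound; it lies below the claimed 128.
    _ = 18 * ((m : ℝ) * σw ^ 2 * (‖R‖ + Υ ^ 3) * Υ ^ 4 * ‖Pstar‖ ^ 2 * (εm + E) ^ 2) := by ring
    _ ≤ 128 * ((m : ℝ) * σw ^ 2 * (‖R‖ + Υ ^ 3) * Υ ^ 4 * ‖Pstar‖ ^ 2 * (εm + E) ^ 2) := by
        gcongr
        norm_num
    _ = _ := by ring
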